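/- For a discrete probability law $\nu$ put $w(\nu)=\sum_z \nu(z)^2$. Let $m\ge 0$ be an integer. (1) Let $Z^{(1)},\dots,Z^{(m)}$ be i.i.d. random variables with discrete law $\nu$, and let $(\widetilde Z^{(1)},\dots,\widetilde Z^{(m)})$ be an independent copy of the tuple $(Z^{(1)},\dots,Z^{(m)})$. Then $$\Pr\bigl[(Z^{(1)},\dots,Z^{(m)})=(\widetilde Z^{(1)},\dots,\widetilde Z^{(m)})\bigr]=w(\nu)^m .$$ (2) For a prime $p$ let $g(p)=p^+-p$, where $p^+$ is the least prime greater than $p$. For real $X\ge 2$ let $\mu_X$ be the law of $g(P)$, where $P$ is uniformly distributed on the (nonempty) set of primes in $[X,2X]$, and put $w_X=w(\mu_X)=\sum_{h}\mu_X(h)^2$. There is an absolute constant $C>0$ such that for all integers $m\ge 0$ and all real $X\ge 2$: if $G_X^{(1)},\dots,G_X^{(m)}$ are i.i.d. with law $\mu_X$ and $(\widetilde G_X^{(1)},\dots,\widetilde G_X^{(m)})$ is an independent copy of this tuple, then $$\Pr\bigl[(G_X^{(1)},\dots,G_X^{(m)})=(\widetilde G_X^{(1)},\dots,\widetilde G_X^{(m)})\bigr]=(w_X)^m\le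 C^m\left(\frac{\log\log(3X)}{\log X}\right)^m .$$ -/

import Mathlib

open MeasureTheory ProbabilityTheory

/-- The least prime strictly greater than `p`. -/
noncomputable def nextPrime (p : ℕ) : ℕ := sInf {q : ℕ | q.Prime ∧ p < q}

theorem nextPrime_spec (p : ℕ) : (nextPrime p).Prime ∧ p < nextPrime p := by
  obtain ⟨q, hq, hqp⟩ := Nat.exists_infinite_primes (p + 1)
  exact Nat.sInf_mem (s := {q : ℕ | q.Prime ∧ p < q}) ⟨q, hqp, hq⟩

/-- The gap `g(p)` from `p` to the next prime (the subtraction never truncates). -/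
noncomputable def primeGap (p : ℕ) : ℕ := nextPrime p - p

/-- The set of primes in the dyadic interval `[X, 2X]`. -/
noncomputable def dyadicPrimes (X : ℝ) : Finset ℕ :=
  {p ∈ Finset.Icc ⌈X⌉₊ ⌊2 * X⌋₊ | p.Prime}

theorem mem_dyadicPrimes {X : ℝ} (hX : 2 ≤ X) (p : ℕ) :
    p ∈ dyadicPrimes X ↔ p.Prime ∧ X ≤ p ∧ (p : ℝ) ≤ 2 * X := by
  simp only [dyadicPrimes, Finset.mem_filter, Finset.mem_Icc, Nat.ceil_le,
    Nat.le_floor_iff (show (0 : ℝ) ≤ 2 * X by linarith)]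
  tauto

theorem dyadicPrimes_nonempty {X : ℝ} (hX : 2 ≤ X) : (dyadicPrimes X).Nonempty := by
  have h0 : ⌊X⌋₊ ≠ 0 := (Nat.floor_pos.2 (by linarith)).ne'
  obtain ⟨p, hp, h1, h2⟩ := Nat.exists_prime_lt_and_le_two_mul ⌊X⌋₊ h0
  refine ⟨p, (mem_dyadicPrimes hX p).2 ⟨hp, (Nat.lt_of_floor_lt h1).le, ?_⟩⟩
  have h3 : (⌊X⌋₊ : ℝ) ≤ X := Nat.floor_le (by linarith)
  have h4 : (p : ℝ) ≤ 2 * (⌊X⌋₊ : ℝ) := by exact_mod_cast h2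
  linarith

/-- The gap distribution `μ_X`: the law of `g(P)` for `P` uniform among the primes in `[X, 2X]`. -/
noncomputable def gapLaw (X : ℝ) (hX : 2 ≤ X) : PMF ℕ :=
  (PMF.uniformOfFinset (dyadicPrimes X) (dyadicPrimes_nonempty hX)).map primeGap

/-- The collision probability `w(ν) = ∑ z, ν(z)²` of a discrete law `ν`. -/
noncomputable def collisionProb {α : Type*} (ν : PMF α) : ℝ := ∑' z, (ν z).toReal ^ 2

/-- The series defining `collisionProb` always converges. -/
theorem summable_collisionProb {α : Type*} (ν : PMF α) :
    Summable fun z => (ν z).toReal ^ 2 := by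
  have hs : Summable fun z => (ν z).toReal :=
    ENNReal.summable_toReal (by rw [ν.tsum_coe]; exact ENNReal.one_ne_top)
  refine hs.of_nonneg_of_le (fun z => by positivity) (fun z => ?_)
  have h1 : (ν z).toReal ≤ 1 := by
    simpa using ENNReal.toReal_mono ENNReal.one_ne_top (ν.coe_le_one z)
  nlinarith [ENNReal.toReal_nonneg (a := ν z)]

/-- The random variables `Z i` are independent, each with discrete law `ν`. -/
structure IsIID {ι Ω α : Type*} [MeasurableSpace Ω] [MeasurableSpace α]
    (Z : ι → Ω → α) (ν : PMF α) (P : Measure Ω) : Prop where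
  hasLaw : ∀ i, HasLaw (Z i) ν.toMeasure P
  indep : iIndepFun Z P

/-- `Z` and `Z'` are i.i.d. `m`-tuples with the same discrete law `ν` for each entry, and the tuple
`Z'` is independent of the tuple `Z`; that is, `Z'` is an independent copy of `Z`. -/
structure IsIIDWithCopy {m : ℕ} {Ω α : Type*} [MeasurableSpace Ω] [MeasurableSpace α]
    (Z Z' : Fin m → Ω → α) (ν : PMF α) (P : Measure Ω) : Prop where
  iid : IsIID Z ν P
  iid_copy : IsIID Z' ν P
  indep_copy : IndepFun (fun ω i => Z i ω) (fun ω i => Z' i ω) P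

/-! Tensorization: by independence, the tuples collide at `s` with probability `∏ ν(s i)²`, and the
sum over all `s` factors as the `m`-th power of `∑ ν²`.

For prime gaps it remains to bound `w_X`, and `∑ ν² ≤ max ν` (`collisionProb_le`) reduces this to
bounding each single gap frequency. If `g(p) = h`, then `p` and `p + h` are both prime. Selberg's
sieve applied to `n (n + h)` bounds the number of such `p` in `[X, 2X]` by a constant times `X /
log² X` times `∏ (1 - 1/p)⁻¹` over `p ∣ h`. That product is `O(log log 3X)`, because `h ≤ 3X` and
the worst case is an `h` with many small prime factors. Chebyshev's lower bound for the number of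
primes in `[X, 2X]` then gives `w_X = O(log log 3X / log X)` for large `X`; bounded `X` are absorbed
in the constant.

The main ingredients are `eventually_le_card_dyadicPrimes` (Chebyshev),
`prod_primeFactors_inv_one_sub_inv_le` (the product over `p ∣ h`), `siftedSum_le_div_selbergSum_add`
(the sieve) and `log_sq_le_mul_selbergSum` (its main term). -/

/-! ### Tensorization of the collision probability. -/

theorem ENNReal.tsum_pi_fin_prod {ι : Type*} (f : ι → ENNReal) (m : ℕ) :
    ∑' s : Fin m → ι, ∏ i, f (s i) = (∑' a, f a) ^ m := by
  induction m with
  | zero => simp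
  | succ m ih =>
    rw [← (Fin.consEquiv fun _ => ι).tsum_eq, ENNReal.tsum_prod', pow_succ', ← ih,
      ← ENNReal.tsum_mul_right]
    refine tsum_congr fun a => ?_
    rw [← ENNReal.tsum_mul_left]
    refine tsum_congr fun s => ?_
    simp [Fin.prod_univ_succ, Fin.consEquiv]

theorem collisionProb_eq_toReal {α : Type*} (ν : PMF α) :
    collisionProb ν = (∑' z : ν.support, ν z ^ 2).toReal := by
  have h : ∑' z : ν.support, ν z ^ 2 = ∑' z, ν z ^ 2 := by
    refine tsum_subtype_eq_of_support_subset (f := fun z => ν z ^ 2) fun z hz => ?_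
    simpa [PMF.mem_support_iff] using hz
  rw [h, collisionProb, ENNReal.tsum_toReal_eq fun z => ENNReal.pow_ne_top (ν.apply_ne_top z)]
  simp

theorem IsIID.measure_eq {m : ℕ} {Ω α : Type*} [MeasurableSpace Ω] [MeasurableSpace α]
    [MeasurableSingletonClass α] {Z : Fin m → Ω → α} {ν : PMF α} {P : Measure Ω}
    (h : IsIID Z ν P) (s : Fin m → α) :
    P ((fun ω i => Z i ω) ⁻¹' {s}) = ∏ i, ν (s i) := by
  have h1 : (fun ω i => Z i ω) ⁻¹' {s} = ⋂ i ∈ (Finset.univ : Finset (Fin m)), Z i ⁻¹' {s i} := by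
    ext ω
    simp [funext_iff]
  rw [h1, h.indep.measure_inter_preimage_eq_mul Finset.univ
    (sets := fun i => {s i}) fun i _ => measurableSet_singleton _]
  refine Finset.prod_congr rfl fun i _ => ?_
  rw [← Measure.map_apply_of_aemeasurable (h.hasLaw i).aemeasurable (measurableSet_singleton _),
    (h.hasLaw i).map_eq, PMF.toMeasure_apply_singleton _ _ (measurableSet_singleton _)]

theorem IsIID.ae_mem_support {m : ℕ} {Ω α : Type*} [MeasurableSpace Ω] [MeasurableSpace α]
    [MeasurableSingletonClass α] {Z : Fin m → Ω → α} {ν : PMF α} {P : Measure Ω}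
    (h : IsIID Z ν P) : ∀ᵐ ω ∂P, ∀ i, Z i ω ∈ ν.support := by
  rw [ae_all_iff]
  intro i
  have hm : MeasurableSet ν.support := ν.support_countable.measurableSet
  refine ae_of_ae_map (h.hasLaw i).aemeasurable (p := fun a => a ∈ ν.support) ?_
  rw [(h.hasLaw i).map_eq]
  rw [ae_iff]
  have : {a | a ∉ ν.support} = ν.supportᶜ := rfl
  rw [this, PMF.toMeasure_apply_eq_zero_iff _ hm.compl]
  exact disjoint_compl_right

/-- The space `α` may be uncountable, with a non-measurable diagonal. Almost surely the values lie
in the countable support of `ν`, so the collision event agrees a.e. with a countable disjoint union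
of events `Z = s = Z'`, on which independence applies. -/
theorem IsIIDWithCopy.measureReal_eq {m : ℕ} {Ω α : Type*} [MeasurableSpace Ω] [MeasurableSpace α]
    [MeasurableSingletonClass α] {Z Z' : Fin m → Ω → α} {ν : PMF α} {P : Measure Ω}
    (h : IsIIDWithCopy Z Z' ν P) :
    P.real {ω | (fun i => Z i ω) = (fun i => Z' i ω)} = collisionProb ν ^ m := by
  have : Countable ν.support := ν.support_countable
  let A : (Fin m → ν.support) → Set Ω := fun s =>
    (fun ω i => Z i ω) ⁻¹' {fun i => (s i : α)} ∩ (fun ω i => Z' i ω) ⁻¹' {fun i => (s i : α)}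
  have hA : {ω | (fun i => Z i ω) = (fun i => Z' i ω)} =ᵐ[P] ⋃ s, A s := by
    filter_upwards [h.iid.ae_mem_support] with ω hω
    refine propext ⟨fun he => ?_, fun he => ?_⟩
    · refine Set.mem_iUnion.2 ⟨fun i => ⟨Z i ω, hω i⟩, ?_⟩
      exact ⟨rfl, he.symm⟩
    · obtain ⟨s, h1, h2⟩ := Set.mem_iUnion.1 he
      exact Eq.trans h1 (Eq.symm h2)
  have hZ : AEMeasurable (fun ω i => Z i ω) P :=
    aemeasurable_pi_lambda _ fun i => (h.iid.hasLaw i).aemeasurable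
  have hZ' : AEMeasurable (fun ω i => Z' i ω) P :=
    aemeasurable_pi_lambda _ fun i => (h.iid_copy.hasLaw i).aemeasurable
  rw [Measure.real, measure_congr hA, measure_iUnion₀, collisionProb_eq_toReal, ← ENNReal.toReal_pow,
    ← ENNReal.tsum_pi_fin_prod]
  · congr 1
    refine tsum_congr fun s => ?_
    rw [h.indep_copy.measure_inter_preimage_eq_mul _ _ (measurableSet_singleton _)
      (measurableSet_singleton _), h.iid.measure_eq, h.iid_copy.measure_eq, ← Finset.prod_mul_distrib]
    simp [sq]
  · intro s t hst
    refine Disjoint.aedisjoint (Set.disjoint_left.2 fun ω h1 h2 => hst ?_)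
    funext i
    exact Subtype.ext (congrFun (Eq.trans (Eq.symm h1.1) h2.1) i)
  · exact fun s => (hZ.nullMeasurableSet_preimage (measurableSet_singleton _)).inter
      (hZ'.nullMeasurableSet_preimage (measurableSet_singleton _))

/-! ### Chebyshev's lower bound for primes in `[X, 2X]`. -/

/-- Erdős's proof of Bertrand's postulate, made quantitative. Each prime power in the factorization
is at most `2n`, primes above `√(2n)` occur at most once, and primes in `(2n/3, n]` do not occur.
The primes up to `2n/3` that occur once are controlled by the primorial bound; the last factor comes
from the primes in `(n, 2n]`. -/
theorem Nat.centralBinom_le_mul_pow_card_primes (n : ℕ) (hn : 2 < n) :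
    n.centralBinom ≤ (2 * n) ^ Nat.sqrt (2 * n) * 4 ^ (2 * n / 3) *
      (2 * n) ^ (Finset.card {p ∈ Finset.Ioc n (2 * n) | p.Prime}) := by
  let f : ℕ → ℕ := fun x => x ^ n.centralBinom.factorization x
  have hn0 : 0 < n := by lia
  have hf : ∀ p, f p ≤ 2 * n := fun p => Nat.pow_factorization_choose_le (by lia)
  let S := {p ∈ Finset.range (2 * n / 3 + 1) | p.Prime}
  let T := {p ∈ Finset.Ioc n (2 * n) | p.Prime}
  have hdisj : Disjoint S T := by
    refine Finset.disjoint_left.2 fun p hp hp' => ?_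
    simp only [S, T, Finset.mem_filter, Finset.mem_range, Finset.mem_Ioc] at hp hp'
    lia
  have hprod : n.centralBinom = (∏ p ∈ S, f p) * ∏ p ∈ T, f p := by
    rw [← Finset.prod_union hdisj]
    refine (Eq.trans ?_ n.prod_pow_factorization_centralBinom).symm
    refine Finset.prod_subset ?_ fun p hp hpn => ?_
    · intro p hp
      simp only [S, T, Finset.mem_union, Finset.mem_filter, Finset.mem_range, Finset.mem_Ioc] at hp ⊢
      lia
    · by_cases hpp : p.Prime
      · have h1 : p ≤ n := by
          by_contra h
          refine hpn (Finset.mem_union_right _ ?_)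
          simp only [T, Finset.mem_filter, Finset.mem_Ioc, Finset.mem_range] at hp ⊢
          exact ⟨by lia, hpp⟩
        have h2 : 2 * n < 3 * p := by
          by_contra h
          refine hpn (Finset.mem_union_left _ ?_)
          simp only [S, Finset.mem_filter, Finset.mem_range]
          exact ⟨by lia, hpp⟩
        simp only [f]
        rw [Nat.factorization_centralBinom_of_two_mul_self_lt_three_mul hn h1 h2, Nat.pow_zero]
      · simp only [f]
        rw [Nat.factorization_eq_zero_of_not_prime n.centralBinom hpp, Nat.pow_zero]
  have hT : ∏ p ∈ T, f p ≤ (2 * n) ^ T.card := Finset.prod_le_pow_card _ _ _ fun p _ => hf p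
  rw [hprod, ← Finset.prod_filter_mul_prod_filter_not S (· ≤ Nat.sqrt (2 * n))]
  refine mul_le_mul' (mul_le_mul' ?_ ?_) hT
  · refine (Finset.prod_le_pow_card _ _ _ fun p _ => hf p).trans ?_
    refine pow_right_mono₀ (by lia) ?_
    refine (Finset.card_le_card (t := Finset.Icc 1 (Nat.sqrt (2 * n))) fun x hx => ?_).trans
      (by simp)
    obtain ⟨h1, h2⟩ := Finset.mem_filter.1 hx
    exact Finset.mem_Icc.mpr ⟨(Finset.mem_filter.1 h1).2.one_lt.le, h2⟩
  · refine le_trans ?_ (primorial_le_four_pow (2 * n / 3))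
    refine (Finset.prod_le_prod' fun p hp => (?_ : f p ≤ p)).trans ?_
    · obtain ⟨h1, h2⟩ := Finset.mem_filter.1 hp
      refine (pow_right_mono₀ (Finset.mem_filter.1 h1).2.one_lt.le ?_).trans (pow_one p).le
      exact Nat.factorization_choose_le_one (Nat.sqrt_lt'.mp <| not_le.1 h2)
    · refine Finset.prod_le_prod_of_subset_of_one_le' (Finset.filter_subset _ _) ?_
      exact fun p hp _ => (Finset.mem_filter.1 hp).2.one_lt.le

/-- Logarithms of the preceding bound against `4 ^ n < n * centralBinom n`. The gain is `(n - 2n/3)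
log 4 ≥ n/3`, and the `+ 1` next to the square root pays for `log n`. -/
theorem le_card_primes_Ioc_mul_log (n : ℕ) (hn : 4 ≤ n) :
    (n : ℝ) / 3 - (√(2 * n) + 1) * Real.log (2 * n) ≤
      (Finset.card {p ∈ Finset.Ioc n (2 * n) | p.Prime}) * Real.log (2 * n) := by
  set k := Finset.card {p ∈ Finset.Ioc n (2 * n) | p.Prime}
  have hn0 : (0 : ℝ) < n := by exact_mod_cast (by lia : 0 < n)
  have h1 : 4 ^ n ≤ n * ((2 * n) ^ Nat.sqrt (2 * n) * 4 ^ (2 * n / 3) * (2 * n) ^ k) :=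
    (Nat.four_pow_lt_mul_centralBinom n hn).le.trans
      (Nat.mul_le_mul_left _ (Nat.centralBinom_le_mul_pow_card_primes n (by lia)))
  have h2 : ((4 : ℝ) ^ n) ≤ n * ((2 * n) ^ Nat.sqrt (2 * n) * 4 ^ (2 * n / 3) * (2 * n) ^ k) := by
    exact_mod_cast h1
  have h3 := Real.log_le_log (by positivity) h2
  rw [Real.log_mul (by positivity) (by positivity), Real.log_mul (by positivity) (by positivity),
    Real.log_mul (by positivity) (by positivity), Real.log_pow, Real.log_pow, Real.log_pow,
    Real.log_pow] at h3
  have hL : 0 ≤ Real.log (2 * n) := Real.log_nonneg (by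
    have : (4 : ℝ) ≤ n := by exact_mod_cast hn
    linarith)
  have h4 : Real.log n ≤ Real.log (2 * n) := Real.log_le_log hn0 (by linarith)
  have h5 : (Nat.sqrt (2 * n) : ℝ) ≤ √(2 * n) := by
    have := Real.nat_sqrt_le_real_sqrt (a := 2 * n)
    push_cast at this
    exact this
  have h6 : ((2 * n / 3 : ℕ) : ℝ) ≤ 2 * n / 3 := by
    have := Nat.cast_div_le (α := ℝ) (m := 2 * n) (n := 3)
    push_cast at this
    exact this
  have h7 : (1 : ℝ) ≤ Real.log 4 := by
    have : Real.log 4 = 2 * Real.log 2 := by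
      rw [show (4 : ℝ) = 2 ^ 2 by norm_num, Real.log_pow]; norm_num
    linarith [Real.log_two_gt_d9]
  have h8 := mul_le_mul_of_nonneg_right h5 hL
  have h9 := mul_le_mul_of_nonneg_right h6 (by linarith : (0 : ℝ) ≤ Real.log 4)
  nlinarith [mul_le_mul_of_nonneg_left h7 hn0.le]

open Filter Asymptotics in
theorem eventually_le_card_dyadicPrimes :
    ∀ᶠ X : ℝ in atTop, X / (24 * Real.log X) ≤ (dyadicPrimes X).card := by
  have ho : (fun x : ℝ => Real.log x) =o[atTop] fun x => x ^ (1 / 2 : ℝ) :=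
    isLittleO_log_rpow_atTop (by norm_num)
  -- With `1/72` the error `6 √X log X` is at most `X/12`, and `(X - 1)/3 - X/12 ≥ X/12`; dividing
  -- by `2 log X` gives the constant `24`.
  filter_upwards [ho.bound (show (0 : ℝ) < 1 / 72 by norm_num), eventually_ge_atTop 5] with X hX hX5
  have hlog : 0 < Real.log X := Real.log_pos (by linarith)
  rw [Real.norm_of_nonneg hlog.le, Real.norm_of_nonneg (by positivity), ← Real.sqrt_eq_rpow] at hX
  have hn : 4 ≤ ⌊X⌋₊ := Nat.le_floor (by push_cast; linarith)
  have hn1 : (⌊X⌋₊ : ℝ) ≤ X := Nat.floor_le (by linarith)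
  have hn2 : X - 1 < ⌊X⌋₊ := Nat.sub_one_lt_floor X
  have h1 := le_card_primes_Ioc_mul_log _ hn
  have hcard : Finset.card {p ∈ Finset.Ioc ⌊X⌋₊ (2 * ⌊X⌋₊) | p.Prime} ≤ (dyadicPrimes X).card := by
    refine Finset.card_le_card fun p hp => ?_
    simp only [Finset.mem_filter, Finset.mem_Ioc] at hp
    refine (mem_dyadicPrimes (by linarith) p).2 ⟨hp.2, (Nat.lt_of_floor_lt hp.1.1).le, ?_⟩
    have : (p : ℝ) ≤ 2 * ⌊X⌋₊ := by exact_mod_cast hp.1.2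
    linarith
  have hcard' : ((Finset.card {p ∈ Finset.Ioc ⌊X⌋₊ (2 * ⌊X⌋₊) | p.Prime} : ℕ) : ℝ) ≤
    (dyadicPrimes X).card := by exact_mod_cast hcard
  have hL : Real.log (2 * ⌊X⌋₊) ≤ 2 * Real.log X := by
    rw [show 2 * Real.log X = Real.log (X ^ 2) by rw [Real.log_pow]; norm_num]
    exact Real.log_le_log (by linarith) (by nlinarith)
  have hL0 : 0 ≤ Real.log (2 * ⌊X⌋₊) := Real.log_nonneg (by linarith)
  have hs : √(2 * ⌊X⌋₊) + 1 ≤ 3 * √X := by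
    have h2 : √(2 * ⌊X⌋₊) ≤ 2 * √X := by
      refine Real.sqrt_le_iff.2 ⟨by positivity, ?_⟩
      rw [mul_pow, Real.sq_sqrt (by linarith)]
      linarith
    have h3 : 1 ≤ √X := Real.one_le_sqrt.2 (by linarith)
    linarith
  have hsX : √X * √X = X := Real.mul_self_sqrt (by linarith)
  rw [div_le_iff₀ (by positivity)]
  have h4 : (√(2 * ⌊X⌋₊) + 1) * Real.log (2 * ⌊X⌋₊) ≤ 3 * √X * (2 * Real.log X) :=
    mul_le_mul hs hL hL0 (by positivity)
  have h5 : √X * Real.log X ≤ √X * (1 / 72 * √X) := mul_le_mul_of_nonneg_left hX (by positivity)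
  have h6 := mul_le_mul hcard' hL hL0 (by positivity)
  nlinarith

/-! ### Mertens-type bounds for sums of `log p / p`. -/

theorem Nat.Prime.pow_div_dvd_factorial {p : ℕ} (hp : p.Prime) (n : ℕ) :
    p ^ (n / p) ∣ n.factorial := by
  have h : p ^ (n / p) ∣ (p * (n / p)).factorial := by
    generalize n / p = k
    induction k with
    | zero => simp
    | succ k ih =>
      rw [← Nat.mul_factorial_pred (Nat.mul_pos hp.pos k.succ_pos).ne', pow_succ']
      refine mul_dvd_mul (Dvd.intro _ rfl) (ih.trans (Nat.factorial_dvd_factorial ?_))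
      have := hp.pos
      rw [Nat.mul_succ]
      lia
  exact h.trans (Nat.factorial_dvd_factorial (Nat.mul_div_le n p))

/-- The upper half of Mertens's first theorem: the powers `p ^ ⌊n/p⌋` jointly divide `n! ≤ n ^ n`,
and replacing `⌊n/p⌋` by `n/p` costs at most `θ(n) ≤ n log 4`. -/
theorem sum_log_div_primes_le (n : ℕ) :
    ∑ p ∈ Finset.Icc 1 n with p.Prime, Real.log p / p ≤ Real.log n + Real.log 4 := by
  rcases n.eq_zero_or_pos with rfl | hn
  · simp; exact Real.log_nonneg (by norm_num)
  have h1 : ∏ p ∈ Finset.Icc 1 n with p.Prime, p ^ (n / p) ≤ n ^ n := by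
    refine (Nat.le_of_dvd n.factorial_pos ?_).trans n.factorial_le_pow
    refine Finset.prod_dvd_of_isRelPrime (fun p hp q hq hpq => ?_) fun p hp => ?_
    · simp only [Finset.coe_filter, Set.mem_ofPred_eq] at hp hq
      exact Nat.coprime_iff_isRelPrime.1
        (Nat.Coprime.pow _ _ ((Nat.coprime_primes hp.2 hq.2).2 hpq))
    · exact (Finset.mem_filter.1 hp).2.pow_div_dvd_factorial n
  have h2 : ∑ p ∈ Finset.Icc 1 n with p.Prime, ((n / p : ℕ) : ℝ) * Real.log p ≤ n * Real.log n := by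
    have h3 : Real.log (∏ p ∈ Finset.Icc 1 n with p.Prime, (p : ℝ) ^ (n / p)) ≤
        Real.log ((n : ℝ) ^ n) := by
      refine Real.log_le_log (Finset.prod_pos fun p hp => ?_) (by exact_mod_cast h1)
      have := (Finset.mem_filter.1 hp).2.pos
      positivity
    rw [Real.log_prod, Real.log_pow] at h3
    · simpa [Real.log_pow] using h3
    · intro p hp
      have := (Finset.mem_filter.1 hp).2.ne_zero
      positivity
  have hθ : ∑ p ∈ Finset.Icc 1 n with p.Prime, Real.log p ≤ Real.log 4 * n := by
    have := Chebyshev.theta_le_log4_mul_x (x := n) (by positivity)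
    simpa [Chebyshev.theta, ← Finset.Icc_succ_left_eq_Ioc] using this
  have hn' : (0 : ℝ) < n := by exact_mod_cast hn
  refine le_of_mul_le_mul_left ?_ hn'
  calc (n : ℝ) * ∑ p ∈ Finset.Icc 1 n with p.Prime, Real.log p / p
      ≤ ∑ p ∈ Finset.Icc 1 n with p.Prime, (((n / p : ℕ) : ℝ) * Real.log p + Real.log p) := by
        rw [Finset.mul_sum]
        refine Finset.sum_le_sum fun p hp => ?_
        have hp' := (Finset.mem_filter.1 hp).2
        have hl : 0 ≤ Real.log p := Real.log_natCast_nonneg p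
        have h4 : (n : ℝ) / p ≤ ((n / p : ℕ) : ℝ) + 1 := by
          rw [← Nat.floor_div_eq_div (K := ℝ)]
          exact (Nat.lt_floor_add_one _).le
        calc (n : ℝ) * (Real.log p / p) = n / p * Real.log p := by ring
          _ ≤ (((n / p : ℕ) : ℝ) + 1) * Real.log p := mul_le_mul_of_nonneg_right h4 hl
          _ = _ := by ring
    _ ≤ n * Real.log n + Real.log 4 * n := by
        rw [Finset.sum_add_distrib]
        exact add_le_add h2 hθ
    _ = _ := by ring

/-- Split at `L = log Y`. Primes up to `L` contribute at most `log L + log 4` by Mertens. There are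
at most `log h / log 2 ≤ 2L` larger prime factors, each contributing at most `log L / L`, since `log
x / x` decreases beyond `e`. -/
theorem sum_log_div_primeFactors_le {h : ℕ} (hh : h ≠ 0) {Y : ℝ} (hY : Real.exp 3 ≤ Y)
    (hhY : (h : ℝ) ≤ Y) :
    ∑ p ∈ h.primeFactors, Real.log p / p ≤ 5 * Real.log (Real.log Y) := by
  set L := Real.log Y
  have hY0 : 0 < Y := (Real.exp_pos 3).trans_le hY
  have hL : 3 ≤ L := (Real.le_log_iff_exp_le hY0).2 hY
  have he : Real.exp 1 ≤ L := by linarith [Real.exp_one_lt_d9]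
  have hlL : 1 ≤ Real.log L := (Real.le_log_iff_exp_le (by linarith)).2 he
  have hl4 : Real.log 4 = 2 * Real.log 2 := by
    rw [show (4 : ℝ) = 2 ^ 2 by norm_num, Real.log_pow]; norm_num
  rw [← Finset.sum_filter_add_sum_filter_not _ fun p : ℕ => (p : ℝ) ≤ L]
  have h1 : ∑ p ∈ h.primeFactors with (p : ℕ) ≤ L, Real.log p / p ≤ Real.log L + Real.log 4 := by
    refine le_trans ?_ ((sum_log_div_primes_le ⌊L⌋₊).trans (by
      gcongr
      · exact_mod_cast Nat.floor_pos.2 (by linarith)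
      · exact Nat.floor_le (by linarith)))
    refine Finset.sum_le_sum_of_subset_of_nonneg (fun p hp => ?_) fun p _ _ =>
      div_nonneg (Real.log_natCast_nonneg p) (Nat.cast_nonneg p)
    simp only [Finset.mem_filter, Nat.mem_primeFactors, Finset.mem_Icc] at hp ⊢
    exact ⟨⟨hp.1.1.pos, Nat.le_floor hp.2⟩, hp.1.1⟩
  have hcard : (h.primeFactors.card : ℝ) * Real.log 2 ≤ L := by
    have h2 : 2 ^ h.primeFactors.card ≤ h := by
      refine le_trans ?_ (Nat.le_of_dvd (Nat.pos_of_ne_zero hh) (Nat.prod_primeFactors_dvd h))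
      exact Finset.pow_card_le_prod _ _ _ fun p hp => (Nat.prime_of_mem_primeFactors hp).two_le
    have h3 : (2 : ℝ) ^ h.primeFactors.card ≤ h := by exact_mod_cast h2
    rw [← Real.log_pow]
    exact Real.log_le_log (by positivity) (h3.trans hhY)
  have h2 : ∑ p ∈ h.primeFactors with ¬ ((p : ℕ) : ℝ) ≤ L, Real.log p / p ≤ 2 * Real.log L := by
    refine (Finset.sum_le_card_nsmul _ _ (Real.log L / L) fun p hp => ?_).trans ?_
    · have hp' := not_le.1 (Finset.mem_filter.1 hp).2
      exact Real.log_div_self_antitoneOn he (he.trans hp'.le) hp'.le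
    · rw [nsmul_eq_mul]
      have h3 : (Finset.card {p ∈ h.primeFactors | ¬ ((p : ℕ) : ℝ) ≤ L} : ℝ) ≤ 2 * L := by
        refine le_trans (by exact_mod_cast Finset.card_filter_le _ _) (?_ : (h.primeFactors.card : ℝ) ≤ _)
        nlinarith [Real.log_two_gt_d9, (Nat.cast_nonneg h.primeFactors.card : (0 : ℝ) ≤ _)]
      calc _ ≤ 2 * L * (Real.log L / L) :=
            mul_le_mul_of_nonneg_right h3 (by positivity)
        _ = _ := by field_simp
  linarith [Real.log_two_lt_d9]

/-! ### Euler products over the prime divisors of `h`. -/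

/-- Comparison with `1 + ∫ x ^ (-1-σ)` over `[1, n+1]`, in a form that telescopes under induction.
The term `k = 0` vanishes because zero to a nonzero real power is `0`. -/
theorem sum_range_rpow_neg_le {σ : ℝ} (hσ : 0 < σ) (n : ℕ) :
    ∑ k ∈ Finset.range (n + 2), (k : ℝ) ^ (-(1 + σ)) ≤ 1 + 1 / σ - ((n : ℝ) + 1) ^ (-σ) / σ := by
  induction n with
  | zero => simp [Finset.sum_range_succ, Real.zero_rpow (by linarith : -σ + -1 ≠ 0)]
  | succ n ih =>
    rw [Finset.sum_range_succ]
    refine (add_le_add_left ih _).trans ?_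
    have hx : (0 : ℝ) < (n : ℝ) + 1 := by positivity
    have hy : (0 : ℝ) < (n : ℝ) + 2 := by positivity
    have h1 : 1 - ((n : ℝ) + 1) / (n + 2) ≤ Real.log ((n + 2) / (n + 1)) := by
      have := Real.one_sub_inv_le_log_of_pos (div_pos hy hx)
      rwa [inv_div] at this
    have h2 : ((n : ℝ) + 1) ^ (-σ) =
        ((n : ℝ) + 2) ^ (-σ) * Real.exp (σ * Real.log ((n + 2) / (n + 1))) := by
      rw [Real.rpow_def_of_pos hx, Real.rpow_def_of_pos hy, ← Real.exp_add,
        Real.log_div hy.ne' hx.ne']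
      congr 1; ring
    have h3 := Real.add_one_le_exp (σ * Real.log (((n : ℝ) + 2) / (n + 1)))
    have h4 : ((n : ℝ) + 2) ^ (-(1 + σ)) = ((n : ℝ) + 2) ^ (-σ) * (1 - ((n : ℝ) + 1) / (n + 2)) := by
      rw [show -(1 + σ) = -σ + -1 by ring, Real.rpow_add hy, Real.rpow_neg_one]
      field_simp; ring
    have hz : 0 < ((n : ℝ) + 2) ^ (-σ) := Real.rpow_pos_of_pos hy _
    push_cast
    rw [show (n : ℝ) + 1 + 1 = n + 2 by ring, h4, h2]
    set z := ((n : ℝ) + 2) ^ (-σ)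
    set E := Real.exp (σ * Real.log (((n : ℝ) + 2) / (n + 1)))
    have h5 : σ * (1 - ((n : ℝ) + 1) / (n + 2)) ≤ E - 1 := by
      have := mul_le_mul_of_nonneg_left h1 hσ.le
      linarith
    have h6 : 1 - ((n : ℝ) + 1) / (n + 2) ≤ (E - 1) / σ := by
      rw [le_div_iff₀ hσ]; linarith
    have h7 := mul_le_mul_of_nonneg_left h6 hz.le
    have h8 : z * E / σ = z * ((E - 1) / σ) + z / σ := by ring
    linarith

/-- A finite Euler product is a subsum of the series for `ζ(1 + σ)`, which is at most `1 + 1/σ`. -/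
theorem prod_inv_one_sub_rpow_le (s : Finset ℕ) {σ : ℝ} (hσ : 0 < σ) :
    ∏ p ∈ s with p.Prime, (1 - (p : ℝ) ^ (-(1 + σ)))⁻¹ ≤ 1 + 1 / σ := by
  have hne : -(1 + σ) ≠ 0 := by linarith
  let f : ℕ →*₀ ℝ :=
    { toFun := fun n => (n : ℝ) ^ (-(1 + σ))
      map_zero' := by rw [Nat.cast_zero, Real.zero_rpow hne]
      map_one' := by simp
      map_mul' := fun m n => by
        push_cast
        exact Real.mul_rpow (Nat.cast_nonneg m) (Nat.cast_nonneg n) }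
  have hf0 : ∀ n, 0 ≤ f n := fun n => Real.rpow_nonneg (Nat.cast_nonneg n) _
  have hle : ∀ n, ∑ k ∈ Finset.range n, f k ≤ 1 + 1 / σ := fun n => by
    refine (Finset.sum_le_sum_of_subset_of_nonneg (Finset.range_mono (by lia : n ≤ n + 2))
      fun k _ _ => hf0 k).trans ((sum_range_rpow_neg_le hσ n).trans ?_)
    have : 0 ≤ ((n : ℝ) + 1) ^ (-σ) / σ := by positivity
    linarith
  have hs : Summable f := summable_of_sum_range_le hf0 hle
  have h1 := EulerProduct.prod_filter_prime_geometric_eq_tsum_factoredNumbers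
    (f := (f : ℕ →* ℝ)) hs s
  refine (le_of_eq h1).trans ((Summable.tsum_subtype_le _ _ hf0 hs).trans
    (Real.tsum_le_of_sum_range_le hf0 hle))

/-- Rankin's trick: moving the exponent from `1` to `1 + σ` costs each prime a factor at most `1 +
2tx ≤ exp (2tx)`, where `x = 1/p ≤ 1/2` and `t = σ log p`. -/
theorem prod_inv_one_sub_inv_le (s : Finset ℕ) {σ : ℝ} (hσ : 0 < σ) :
    ∏ p ∈ s with p.Prime, (1 - (p : ℝ)⁻¹)⁻¹ ≤
      (1 + 1 / σ) * Real.exp (2 * σ * ∑ p ∈ s with p.Prime, Real.log p / p) := by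
  refine le_trans ?_ (mul_le_mul_of_nonneg_right (prod_inv_one_sub_rpow_le s hσ)
    (Real.exp_pos _).le)
  rw [Finset.mul_sum, Real.exp_sum, ← Finset.prod_mul_distrib]
  refine Finset.prod_le_prod (fun p hp => ?_) fun p hp => ?_
  · have hp2 : (2 : ℝ) ≤ p := by exact_mod_cast (Finset.mem_filter.1 hp).2.two_le
    exact inv_nonneg.2 (sub_nonneg.2 (inv_le_one_of_one_le₀ (by linarith)))
  · have hp2 : (2 : ℝ) ≤ p := by exact_mod_cast (Finset.mem_filter.1 hp).2.two_le
    have hp0 : (0 : ℝ) < p := by linarith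
    have hx : (p : ℝ)⁻¹ ≤ 1 / 2 := by rw [inv_le_comm₀ hp0 (by norm_num)]; linarith
    have hx0 : 0 < (p : ℝ)⁻¹ := inv_pos.2 hp0
    have hr : (p : ℝ) ^ (-(1 + σ)) = (p : ℝ)⁻¹ * Real.exp (-(σ * Real.log p)) := by
      rw [show -(1 + σ) = -1 + -σ by ring, Real.rpow_add hp0, Real.rpow_neg_one,
        Real.rpow_def_of_pos hp0]
      congr 2; ring
    set x := (p : ℝ)⁻¹
    set t := σ * Real.log p
    have ht : 0 ≤ t := mul_nonneg hσ.le (Real.log_natCast_nonneg p)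
    have he1 : Real.exp (-t) ≤ 1 := Real.exp_le_one_iff.2 (by linarith)
    have he2 : 1 - t ≤ Real.exp (-t) := by linarith [Real.add_one_le_exp (-t)]
    have he3 : 1 + 2 * t * x ≤ Real.exp (2 * σ * (Real.log p / p)) := by
      rw [show 2 * σ * (Real.log p / p) = 2 * t * x by simp only [t, x]; ring]
      linarith [Real.add_one_le_exp (2 * t * x)]
    rw [hr]
    have hpos : 0 < 1 - x * Real.exp (-t) := by nlinarith
    rw [inv_mul_eq_div, le_div_iff₀ hpos, inv_mul_le_iff₀ (by linarith)]
    nlinarith [mul_nonneg ht hx0.le, mul_nonneg (mul_nonneg ht hx0.le) (by linarith : 0 ≤ 1/2 - x)]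

theorem prod_primeFactors_inv_one_sub_inv_le {h : ℕ} (hh : h ≠ 0) {Y : ℝ} (hY : Real.exp 3 ≤ Y)
    (hhY : (h : ℝ) ≤ Y) :
    ∏ p ∈ h.primeFactors, (1 - (p : ℝ)⁻¹)⁻¹ ≤ 2 * Real.exp 10 * Real.log (Real.log Y) := by
  have h1 := sum_log_div_primeFactors_le hh hY hhY
  have hY0 : 0 < Y := (Real.exp_pos 3).trans_le hY
  have hL : 3 ≤ Real.log Y := (Real.le_log_iff_exp_le hY0).2 hY
  have hlL : 1 ≤ Real.log (Real.log Y) :=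
    (Real.le_log_iff_exp_le (by linarith)).2 (by linarith [Real.exp_one_lt_d9])
  set M := Real.log (Real.log Y)
  -- With `σ = 1/M` the exponent is at most `(2/M)(5M) = 10`, while `1 + 1/σ = 1 + M ≤ 2M`.
  have h2 := prod_inv_one_sub_inv_le h.primeFactors (σ := 1 / M) (by positivity)
  have hf : {p ∈ h.primeFactors | p.Prime} = h.primeFactors :=
    Finset.filter_true_of_mem fun p hp => Nat.prime_of_mem_primeFactors hp
  rw [hf] at h2
  refine h2.trans ?_
  have h3 : 2 * (1 / M) * ∑ p ∈ h.primeFactors, Real.log p / p ≤ 10 := by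
    calc _ ≤ 2 * (1 / M) * (5 * M) := mul_le_mul_of_nonneg_left h1 (by positivity)
      _ = 10 := by field_simp; norm_num
  calc _ ≤ (2 * M) * Real.exp 10 := by
        refine mul_le_mul ?_ (Real.exp_le_exp.2 h3) (Real.exp_pos _).le (by positivity)
        rw [one_div_one_div]; linarith
    _ = _ := by ring

/-! ### Selberg's upper bound sieve. -/

/-- Dual Möbius inversion, used to pass from the weights to the variables that diagonalize Selberg's
quadratic form. Writing `m = l k` and `d = l e`, what remains is `∑ μ(e)` over `e ∣ k`. -/
theorem sum_moebius_divisors_of_dvd {l m : ℕ} (hm : Squarefree m) :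
    ∑ d ∈ m.divisors with l ∣ d, (ArithmeticFunction.moebius d : ℝ) =
      if l = m then (ArithmeticFunction.moebius l : ℝ) else 0 := by
  by_cases hlm : l ∣ m
  · obtain ⟨k, rfl⟩ := hlm
    have hl : l ≠ 0 := fun h => hm.ne_zero (by simp [h])
    have hk : k ≠ 0 := fun h => hm.ne_zero (by simp [h])
    have h1 : {d ∈ (l * k).divisors | l ∣ d} = k.divisors.image (l * ·) := by
      ext d
      simp only [Finset.mem_filter, Nat.mem_divisors, Finset.mem_image]
      constructor
      · rintro ⟨⟨h1, h2⟩, e, rfl⟩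
        exact ⟨e, ⟨Nat.dvd_of_mul_dvd_mul_left (Nat.pos_of_ne_zero hl) h1, hk⟩, rfl⟩
      · rintro ⟨e, ⟨h1, -⟩, rfl⟩
        exact ⟨⟨Nat.mul_dvd_mul_left l h1, hm.ne_zero⟩, Dvd.intro _ rfl⟩
    rw [h1, Finset.sum_image fun a _ b _ h => Nat.eq_of_mul_eq_mul_left (Nat.pos_of_ne_zero hl) h]
    have hcop : l.Coprime k := Nat.coprime_of_squarefree_mul hm
    have h2 : ∀ e ∈ k.divisors, (ArithmeticFunction.moebius (l * e) : ℝ) =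
        ArithmeticFunction.moebius l * ArithmeticFunction.moebius e := fun e he => by
      rw [ArithmeticFunction.isMultiplicative_moebius.map_mul_of_coprime
        (hcop.coprime_dvd_right (Nat.dvd_of_mem_divisors he))]
      push_cast; rfl
    rw [Finset.sum_congr rfl h2, ← Finset.mul_sum]
    have h3 : ∑ e ∈ k.divisors, (ArithmeticFunction.moebius e : ℝ) = if k = 1 then 1 else 0 := by
      have := ArithmeticFunction.coe_zeta_mul_apply (f := ArithmeticFunction.moebius) (x := k)
      rw [ArithmeticFunction.coe_zeta_mul_moebius, ArithmeticFunction.one_apply] at this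
      exact_mod_cast this.symm
    rw [h3]
    by_cases hk1 : k = 1
    · simp [hk1]
    · rw [if_neg hk1, if_neg, mul_zero]
      intro h
      exact hk1 (Nat.eq_of_mul_eq_mul_left (Nat.pos_of_ne_zero hl) (by rw [mul_one]; exact h.symm))
  · rw [if_neg fun h => hlm h.dvd]
    refine Finset.sum_eq_zero fun d hd => ?_
    simp only [Finset.mem_filter, Nat.mem_divisors] at hd
    exact absurd (hd.2.trans hd.1.1) hlm

namespace BoundingSieve

/-- The sum of `selbergTerms` over the divisors of `prodPrimes` up to the level `D`. -/
noncomputable def selbergSum (s : BoundingSieve) (D : ℕ) : ℝ :=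
  ∑ l ∈ s.prodPrimes.divisors with l ≤ D, s.selbergTerms l

/-- Selberg's optimal weights of level `D`. -/
noncomputable def optimalWeights (s : BoundingSieve) (D d : ℕ) : ℝ :=
  ArithmeticFunction.moebius d / s.nu d *
    ((∑ l ∈ s.prodPrimes.divisors with l ≤ D ∧ d ∣ l, s.selbergTerms l) / s.selbergSum D)

variable {s : BoundingSieve} {D : ℕ}

theorem selbergTerms_pos_of_mem {l : ℕ} (hl : l ∈ s.prodPrimes.divisors) : 0 < s.selbergTerms l :=
  selbergTerms_pos (Nat.dvd_of_mem_divisors hl)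

theorem selbergSum_pos (hD : 1 ≤ D) : 0 < s.selbergSum D := by
  refine Finset.sum_pos (fun l hl => selbergTerms_pos_of_mem (Finset.mem_filter.1 hl).1) ⟨1, ?_⟩
  simp [hD, prodPrimes_ne_zero]

theorem optimalWeights_one (hD : 1 ≤ D) : s.optimalWeights D 1 = 1 := by
  have h : s.selbergSum D ≠ 0 := (selbergSum_pos hD).ne'
  simp only [optimalWeights, isUnit_one, IsUnit.dvd, and_true]
  rw [← selbergSum, div_self h, s.nu_mult.map_one]
  simp

/-- Weaker than the classical bound by `1`, but immediate: the sum over multiples of `d` is part of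
`selbergSum`, and it is empty when `d > D`. -/
theorem abs_optimalWeights_le (hD : 1 ≤ D) {d : ℕ} (hd : d ∣ s.prodPrimes) :
    |s.optimalWeights D d| ≤ if d ≤ D then (s.nu d)⁻¹ else 0 := by
  have hS := selbergSum_pos (s := s) hD
  have hν := nu_pos_of_dvd_prodPrimes hd
  split_ifs with hdD
  · rw [optimalWeights, abs_mul, abs_div, abs_of_pos hν]
    have h1 : |(ArithmeticFunction.moebius d : ℝ)| ≤ 1 := by
      exact_mod_cast ArithmeticFunction.abs_moebius_le_one
    have h0 : 0 ≤ ∑ l ∈ s.prodPrimes.divisors with l ≤ D ∧ d ∣ l, s.selbergTerms l :=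
      Finset.sum_nonneg fun l hl => (selbergTerms_pos_of_mem (Finset.mem_filter.1 hl).1).le
    have h2 : ∑ l ∈ s.prodPrimes.divisors with l ≤ D ∧ d ∣ l, s.selbergTerms l ≤
        s.selbergSum D := by
      refine Finset.sum_le_sum_of_subset_of_nonneg (fun l hl => ?_) fun l hl _ =>
        (selbergTerms_pos_of_mem (Finset.mem_filter.1 hl).1).le
      simp only [Finset.mem_filter] at hl ⊢
      exact ⟨hl.1, hl.2.1⟩
    rw [abs_of_nonneg (div_nonneg h0 hS.le)]
    calc _ ≤ 1 / s.nu d * 1 := by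
          refine mul_le_mul ?_ ((div_le_one hS).2 h2) (div_nonneg h0 hS.le) (by positivity)
          exact div_le_div_of_nonneg_right h1 hν.le
      _ = _ := by simp
  · have : ∑ l ∈ s.prodPrimes.divisors with l ≤ D ∧ d ∣ l, s.selbergTerms l = 0 := by
      refine Finset.sum_eq_zero fun l hl => ?_
      simp only [Finset.mem_filter, Nat.mem_divisors] at hl
      have := Nat.le_of_dvd (Nat.pos_of_ne_zero fun h => hl.1.2 (by simpa [h] using hl.1.1)) hl.2.2
      lia
    simp [optimalWeights, this]

theorem sum_nu_mul_optimalWeights {l : ℕ} (hl : l ∣ s.prodPrimes) :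
    (∑ d ∈ s.prodPrimes.divisors, if l ∣ d then s.nu d * s.optimalWeights D d else 0) =
      if l ≤ D then ArithmeticFunction.moebius l * s.selbergTerms l / s.selbergSum D else 0 := by
  have h1 : ∀ d ∈ s.prodPrimes.divisors, (if l ∣ d then s.nu d * s.optimalWeights D d else 0) =
      ∑ m ∈ s.prodPrimes.divisors with m ≤ D, s.selbergTerms m / s.selbergSum D *
        if d ∣ m ∧ l ∣ d then (ArithmeticFunction.moebius d : ℝ) else 0 := fun d hd => by
    have hν := (nu_pos_of_dvd_prodPrimes (Nat.dvd_of_mem_divisors hd)).ne'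
    split_ifs with hld
    · rw [optimalWeights, Finset.sum_div, Finset.mul_sum, Finset.mul_sum, ← Finset.filter_filter,
        Finset.sum_filter (fun m => d ∣ m)]
      refine Finset.sum_congr rfl fun m hm => ?_
      simp only [hld, and_true]
      split_ifs
      · field_simp
      · simp
    · simp [hld]
  rw [Finset.sum_congr rfl h1, Finset.sum_comm]
  have h2 : ∀ m ∈ {m ∈ s.prodPrimes.divisors | m ≤ D},
      (∑ d ∈ s.prodPrimes.divisors, s.selbergTerms m / s.selbergSum D *
        if d ∣ m ∧ l ∣ d then (ArithmeticFunction.moebius d : ℝ) else 0) =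
      if l = m then ArithmeticFunction.moebius l * s.selbergTerms l / s.selbergSum D else 0 :=
    fun m hm => by
      have hm' := Nat.dvd_of_mem_divisors (Finset.mem_filter.1 hm).1
      rw [← Finset.mul_sum, ← Finset.sum_filter, ← Finset.filter_filter,
        Nat.divisors_filter_dvd_of_dvd prodPrimes_ne_zero hm',
        sum_moebius_divisors_of_dvd (squarefree_of_dvd_prodPrimes hm')]
      split_ifs with h
      · subst h; ring
      · simp
  rw [Finset.sum_congr rfl h2, Finset.sum_ite_eq]
  simp [hl, prodPrimes_ne_zero]

/-- In the diagonal variables `y_l = μ(l) g(l) / S`, with `g` the Selberg terms and `S` their sum up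
to `D`, the quadratic form is `∑ y_l² / g(l) = ∑ g(l) / S² = 1/S`. -/
theorem mainSum_optimalWeights (hD : 1 ≤ D) :
    s.mainSum (lambdaSquared (s.optimalWeights D)) = (s.selbergSum D)⁻¹ := by
  have hS := (selbergSum_pos (s := s) hD).ne'
  rw [mainSum_lambdaSquared_eq_sum_mul_sum_sq]
  have h1 : ∀ l ∈ s.prodPrimes.divisors, (s.selbergTerms l)⁻¹ *
      (∑ d ∈ s.prodPrimes.divisors, if l ∣ d then s.nu d * s.optimalWeights D d else 0) ^ 2 =
      if l ≤ D then s.selbergTerms l * (s.selbergSum D ^ 2)⁻¹ else 0 := fun l hl => by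
    have hg := (selbergTerms_pos_of_mem hl).ne'
    rw [sum_nu_mul_optimalWeights (Nat.dvd_of_mem_divisors hl)]
    have hμ : (ArithmeticFunction.moebius l : ℝ) ^ 2 = 1 := by
      exact_mod_cast ArithmeticFunction.moebius_sq_eq_one_of_squarefree
        (squarefree_of_mem_divisors_prodPrimes hl)
    split_ifs
    · rw [div_pow, mul_pow, hμ]
      field_simp
    · simp
  rw [Finset.sum_congr rfl h1, ← Finset.sum_filter, ← Finset.sum_mul, ← selbergSum]
  field_simp

/-- Expand over pairs with `d = lcm(d1, d2)`. Since `gcd · ν(gcd) ≥ 1`, the remainder at `d` is at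
most `d1 ν(d1) · d2 ν(d2)`; the factors `ν` cancel against the bound `1/ν` on the weights, leaving
`(∑ d)²` over `d ≤ D`. -/
theorem errSum_optimalWeights_le (hD : 1 ≤ D)
    (hν : ∀ d, d ∣ s.prodPrimes → 1 ≤ d * s.nu d)
    (hrem : ∀ d, d ∣ s.prodPrimes → |s.rem d| ≤ d * s.nu d) :
    s.errSum (lambdaSquared (s.optimalWeights D)) ≤ (D : ℝ) ^ 4 := by
  let B : ℕ → ℝ := fun d => if d ≤ D then (d : ℝ) else 0
  have hB0 : ∀ d, 0 ≤ B d := fun d => by simp only [B]; split_ifs <;> positivity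
  have hw : ∀ d, d ∣ s.prodPrimes → |s.optimalWeights D d| * (d * s.nu d) ≤ B d := fun d hd => by
    have hν := nu_pos_of_dvd_prodPrimes hd
    refine (mul_le_mul_of_nonneg_right (abs_optimalWeights_le hD hd) (by positivity)).trans ?_
    simp only [B]
    split_ifs
    · field_simp; exact le_rfl
    · simp
  have hlcm : ∀ d1 d2, d1 ∣ s.prodPrimes → d2 ∣ s.prodPrimes →
      (d1.lcm d2 : ℝ) * s.nu (d1.lcm d2) ≤ (d1 * s.nu d1) * (d2 * s.nu d2) := fun d1 d2 h1 h2 => by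
    have hg : d1.gcd d2 ∣ s.prodPrimes := (Nat.gcd_dvd_left _ _).trans h1
    have hl : d1.lcm d2 ∣ s.prodPrimes := Nat.lcm_dvd h1 h2
    have e1 : (d1.gcd d2 : ℝ) * d1.lcm d2 = d1 * d2 := by exact_mod_cast Nat.gcd_mul_lcm d1 d2
    have e2 : s.nu (d1.lcm d2) * s.nu (d1.gcd d2) = s.nu d1 * s.nu d2 := s.nu_mult.lcm_apply_mul_gcd_apply
    have hl0 := nu_pos_of_dvd_prodPrimes hl
    calc (d1.lcm d2 : ℝ) * s.nu (d1.lcm d2) = (d1.lcm d2 * s.nu (d1.lcm d2)) * 1 := by ring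
      _ ≤ (d1.lcm d2 * s.nu (d1.lcm d2)) * (d1.gcd d2 * s.nu (d1.gcd d2)) :=
          mul_le_mul_of_nonneg_left (hν _ hg) (by positivity)
      _ = (d1.gcd d2 * d1.lcm d2) * (s.nu (d1.lcm d2) * s.nu (d1.gcd d2)) := by ring
      _ = _ := by rw [e1, e2]; ring
  have hterm : ∀ d ∈ s.prodPrimes.divisors,
      |lambdaSquared (s.optimalWeights D) d| * |s.rem d| ≤
        ∑ d1 ∈ s.prodPrimes.divisors, ∑ d2 ∈ s.prodPrimes.divisors,
          if d = d1.lcm d2 then B d1 * B d2 else 0 := fun d hd => by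
    have hdP := Nat.dvd_of_mem_divisors hd
    have hsub : d.divisors ⊆ s.prodPrimes.divisors := Nat.divisors_subset_of_dvd prodPrimes_ne_zero hdP
    have hnn : ∀ d1 d2, 0 ≤ if d = Nat.lcm d1 d2 then B d1 * B d2 else 0 := fun d1 d2 => by
      split_ifs
      · exact mul_nonneg (hB0 _) (hB0 _)
      · exact le_rfl
    refine le_trans ?_ (Finset.sum_le_sum_of_subset_of_nonneg hsub fun d1 _ _ =>
      Finset.sum_nonneg fun d2 _ => hnn d1 d2)
    refine le_trans ?_ (Finset.sum_le_sum fun d1 _ =>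
      Finset.sum_le_sum_of_subset_of_nonneg hsub fun d2 _ _ => hnn d1 d2)
    refine (mul_le_mul_of_nonneg_right ((Finset.abs_sum_le_sum_abs _ _).trans
      (Finset.sum_le_sum fun d1 _ => Finset.abs_sum_le_sum_abs _ _)) (abs_nonneg _)).trans ?_
    rw [Finset.sum_mul]
    refine Finset.sum_le_sum fun d1 h1 => ?_
    rw [Finset.sum_mul]
    refine Finset.sum_le_sum fun d2 h2 => ?_
    have h1' := (Nat.dvd_of_mem_divisors h1).trans hdP
    have h2' := (Nat.dvd_of_mem_divisors h2).trans hdP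
    split_ifs with hd12
    · rw [abs_mul]
      have h3 : |s.rem d| ≤ (d1 * s.nu d1) * (d2 * s.nu d2) := by
        refine (hrem d hdP).trans ?_
        rw [hd12]
        exact hlcm d1 d2 h1' h2'
      calc _ ≤ |s.optimalWeights D d1| * |s.optimalWeights D d2| *
            ((d1 * s.nu d1) * (d2 * s.nu d2)) := mul_le_mul_of_nonneg_left h3 (by positivity)
        _ = (|s.optimalWeights D d1| * (d1 * s.nu d1)) *
            (|s.optimalWeights D d2| * (d2 * s.nu d2)) := by ring
        _ ≤ _ := mul_le_mul (hw _ h1') (hw _ h2')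
            (mul_nonneg (abs_nonneg _) (zero_le_one.trans (hν _ h2'))) (hB0 _)
    · simp
  refine (Finset.sum_le_sum hterm).trans ?_
  rw [Finset.sum_comm]
  have h4 : ∀ d1 ∈ s.prodPrimes.divisors, (∑ d ∈ s.prodPrimes.divisors,
      ∑ d2 ∈ s.prodPrimes.divisors, if d = d1.lcm d2 then B d1 * B d2 else 0) =
      ∑ d2 ∈ s.prodPrimes.divisors, B d1 * B d2 := fun d1 h1 => by
    rw [Finset.sum_comm]
    refine Finset.sum_congr rfl fun d2 h2 => ?_
    rw [Finset.sum_ite_eq', if_pos]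
    exact Nat.mem_divisors.2 ⟨Nat.lcm_dvd (Nat.dvd_of_mem_divisors h1) (Nat.dvd_of_mem_divisors h2),
      prodPrimes_ne_zero⟩
  rw [Finset.sum_congr rfl h4, ← Finset.sum_mul_sum]
  have h5 : ∑ d ∈ s.prodPrimes.divisors, B d ≤ (D : ℝ) ^ 2 := by
    rw [← Finset.sum_filter]
    have hsub : {d ∈ s.prodPrimes.divisors | d ≤ D} ⊆ Finset.Icc 1 D := fun d hd => by
      simp only [Finset.mem_filter] at hd
      exact Finset.mem_Icc.2 ⟨Nat.pos_of_mem_divisors hd.1, hd.2⟩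
    refine (Finset.sum_le_card_nsmul _ _ (D : ℝ) fun d hd => ?_).trans ?_
    · exact_mod_cast (Finset.mem_filter.1 hd).2
    · have : (Finset.card {d ∈ s.prodPrimes.divisors | d ≤ D}) ≤ D := by
        simpa using Finset.card_le_card hsub
      rw [nsmul_eq_mul, sq]
      exact mul_le_mul_of_nonneg_right (by exact_mod_cast this) (by positivity)
  have h6 : 0 ≤ ∑ d ∈ s.prodPrimes.divisors, B d := Finset.sum_nonneg fun d _ => hB0 d
  calc _ ≤ (D : ℝ) ^ 2 * (D : ℝ) ^ 2 := mul_le_mul h5 h5 h6 (by positivity)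
    _ = _ := by ring

/-- **Selberg's upper bound sieve**, with a crude error term. -/
theorem siftedSum_le_div_selbergSum_add (hD : 1 ≤ D)
    (hν : ∀ d, d ∣ s.prodPrimes → 1 ≤ d * s.nu d)
    (hrem : ∀ d, d ∣ s.prodPrimes → |s.rem d| ≤ d * s.nu d) :
    s.siftedSum ≤ s.totalMass / s.selbergSum D + (D : ℝ) ^ 4 := by
  refine (siftedSum_le_mainSum_errSum_of_upperMoebius _
    (upperMoebius_lambdaSquared _ (optimalWeights_one (s := s) hD))).trans ?_
  rw [mainSum_optimalWeights hD, ← div_eq_mul_inv]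
  exact add_le_add_right (errSum_optimalWeights_le hD hν hrem) _

end BoundingSieve

/-! ### The sieve for prime pairs `p`, `p + h`. -/

/-- The number of roots of `x (x + h)` modulo `d`. -/
noncomputable def shiftRoots (h d : ℕ) : ℕ := Nat.card {x : ZMod d // x * (x + h) = 0}

theorem shiftRoots_one (h : ℕ) : shiftRoots h 1 = 1 := by
  have : Unique {x : ZMod 1 // x * (x + h) = 0} :=
    { default := ⟨0, by simp⟩, uniq := fun x => Subtype.ext (Subsingleton.elim _ _) }
  exact Nat.card_unique

theorem shiftRoots_mul (h : ℕ) {m n : ℕ} (hmn : m.Coprime n) :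
    shiftRoots h (m * n) = shiftRoots h m * shiftRoots h n := by
  rw [shiftRoots, shiftRoots, shiftRoots, ← Nat.card_prod]
  let φ := ZMod.chineseRemainder hmn
  refine Nat.card_congr ((φ.toEquiv.subtypeEquiv
    (q := fun y : ZMod m × ZMod n => y.1 * (y.1 + h) = 0 ∧ y.2 * (y.2 + h) = 0) fun x => ?_).trans
    (Equiv.subtypeProdEquivProd (p := fun y : ZMod m => y * (y + h) = 0)
      (q := fun y : ZMod n => y * (y + h) = 0)))
  rw [← φ.injective.eq_iff, map_mul, map_add, map_natCast, map_zero, Prod.ext_iff]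
  rfl

theorem one_le_shiftRoots (h : ℕ) {d : ℕ} (hd : d ≠ 0) : 1 ≤ shiftRoots h d := by
  have : NeZero d := ⟨hd⟩
  have : Nonempty {x : ZMod d // x * (x + h) = 0} := ⟨⟨0, by simp⟩⟩
  exact Nat.card_pos

theorem shiftRoots_prime (h : ℕ) {p : ℕ} (hp : p.Prime) :
    shiftRoots h p = if p ∣ h then 1 else 2 := by
  have : Fact p.Prime := ⟨hp⟩
  have hset : {x : ZMod p | x * (x + h) = 0} = {0, -(h : ZMod p)} := by
    ext x
    simp [eq_neg_iff_add_eq_zero]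
  have hcard : shiftRoots h p = Set.ncard {x : ZMod p | x * (x + h) = 0} := rfl
  rw [hcard, hset]
  split_ifs with hd
  · rw [(ZMod.natCast_eq_zero_iff h p).2 hd]
    simp
  · rw [Set.ncard_pair]
    intro h0
    exact hd ((ZMod.natCast_eq_zero_iff h p).1 (neg_eq_zero.1 h0.symm))

theorem abs_card_Ico_modEq_sub_le (a M v : ℕ) {d : ℕ} (hd : 0 < d) :
    |((Finset.card {n ∈ Finset.Ico a (a + M) | n ≡ v [MOD d]} : ℕ) : ℝ) - M / d| ≤ 1 := by
  have h1 := Nat.Ico_filter_modEq_card a (a + M) hd v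
  have hd' : (0 : ℚ) < d := by exact_mod_cast hd
  have h2 : (((a + M : ℕ) : ℚ) - v) / d = ((a : ℚ) - v) / d + M / d := by
    push_cast; field_simp; ring
  have h0 : (0 : ℚ) ≤ (M : ℚ) / d := by positivity
  rw [h2] at h1
  set x : ℚ := ((a : ℚ) - v) / d
  set y : ℚ := (M : ℚ) / d
  rw [max_eq_left (sub_nonneg.2 (Int.ceil_le_ceil (by linarith)))] at h1
  have h3 : ((Finset.card {n ∈ Finset.Ico a (a + M) | n ≡ v [MOD d]} : ℕ) : ℚ) =
      (⌈x + y⌉ : ℚ) - ⌈x⌉ := by exact_mod_cast h1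
  have h4 : |((Finset.card {n ∈ Finset.Ico a (a + M) | n ≡ v [MOD d]} : ℕ) : ℚ) - y| ≤ 1 := by
    rw [h3, abs_le]
    have := Int.le_ceil x
    have := Int.ceil_lt_add_one x
    have := Int.le_ceil (x + y)
    have := Int.ceil_lt_add_one (x + y)
    constructor <;> linarith
  have h5 : ((|((Finset.card {n ∈ Finset.Ico a (a + M) | n ≡ v [MOD d]} : ℕ) : ℚ) - y| : ℚ) : ℝ) ≤
      ((1 : ℚ) : ℝ) := by exact_mod_cast h4
  simpa [y] using h5

/-- The condition selects `shiftRoots h d` residue classes modulo `d`, and each class is counted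
with an error of at most one. -/
theorem abs_card_Ico_dvd_sub_le (a M h : ℕ) {d : ℕ} (hd : d ≠ 0) :
    |((Finset.card {n ∈ Finset.Ico a (a + M) | d ∣ n * (n + h)} : ℕ) : ℝ) -
      shiftRoots h d / d * M| ≤ shiftRoots h d := by
  have : NeZero d := ⟨hd⟩
  let R : Finset (ZMod d) := {x | x * (x + h) = 0}
  have hR : shiftRoots h d = R.card := by
    rw [shiftRoots, Nat.card_eq_fintype_card, Fintype.card_subtype]
  have hcard : Finset.card {n ∈ Finset.Ico a (a + M) | d ∣ n * (n + h)} =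
      ∑ x ∈ R, Finset.card {n ∈ Finset.Ico a (a + M) | n ≡ x.val [MOD d]} := by
    rw [Finset.card_eq_sum_card_fiberwise (f := fun n : ℕ => (n : ZMod d)) (t := R)]
    · refine Finset.sum_congr rfl fun x hx => congrArg _ ?_
      ext n
      have hx' : x * (x + h) = 0 := (Finset.mem_filter.1 hx).2
      simp only [Finset.mem_filter, and_assoc, and_congr_right_iff]
      intro _
      have e1 : n ≡ x.val [MOD d] ↔ (n : ZMod d) = x := by
        rw [← ZMod.natCast_eq_natCast_iff, ZMod.natCast_zmod_val]
      rw [e1, and_iff_right_iff_imp]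
      rintro rfl
      rw [← ZMod.natCast_eq_zero_iff]
      exact_mod_cast hx'
    · intro n hn
      have := (Finset.mem_filter.1 hn).2
      rw [← ZMod.natCast_eq_zero_iff] at this
      refine Finset.mem_filter.2 ⟨Finset.mem_univ _, ?_⟩
      rw [← this]
      push_cast
      rfl
  rw [hcard, hR]
  push_cast
  have : (R.card : ℝ) / d * M = ∑ x ∈ R, (M : ℝ) / d := by
    rw [Finset.sum_const, nsmul_eq_mul]; ring
  rw [this, ← Finset.sum_sub_distrib]
  refine (Finset.abs_sum_le_sum_abs _ _).trans ((Finset.sum_le_sum fun x _ =>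
    abs_card_Ico_modEq_sub_le a M x.val (Nat.pos_of_ne_zero hd)).trans ?_)
  simp

/-- The proportion of integers `n` with `d ∣ n (n + h)`, as an arithmetic function of `d`. -/
noncomputable def shiftDensity (h : ℕ) : ArithmeticFunction ℝ :=
  ⟨fun d => shiftRoots h d / d, by simp⟩

theorem shiftDensity_apply (h d : ℕ) : shiftDensity h d = shiftRoots h d / d := rfl

theorem shiftDensity_isMultiplicative (h : ℕ) : (shiftDensity h).IsMultiplicative := by
  refine ⟨by simp [shiftDensity_apply, shiftRoots_one], fun {m n} hmn => ?_⟩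
  rw [shiftDensity_apply, shiftDensity_apply, shiftDensity_apply, shiftRoots_mul h hmn]
  push_cast
  rw [mul_div_mul_comm]

theorem mul_shiftDensity (h : ℕ) {d : ℕ} (hd : d ≠ 0) : d * shiftDensity h d = shiftRoots h d := by
  have : (d : ℝ) ≠ 0 := by exact_mod_cast hd
  rw [shiftDensity_apply]
  field_simp

/-- The sieve problem of removing from the values `n (n + h)`, `a ≤ n < a + M`, the multiples of
the primes up to `z`. -/
noncomputable def shiftSieve (h a M z : ℕ) (hh : Even h) : BoundingSieve where
  support := (Finset.Ico a (a + M)).image fun n => n * (n + h)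
  prodPrimes := primorial z
  prodPrimes_squarefree := squarefree_primorial z
  weights := fun _ => 1
  weights_nonneg := fun _ => zero_le_one
  totalMass := M
  nu := shiftDensity h
  nu_mult := shiftDensity_isMultiplicative h
  nu_pos_of_prime := fun p hp _ => by
    have h1 := one_le_shiftRoots h hp.ne_zero
    have h2 := hp.pos
    rw [shiftDensity_apply]
    positivity
  -- Evenness of `h` matters here: for odd `h` both classes modulo `2` would be removed.
  nu_lt_one_of_prime := fun p hp _ => by
    have h2 : (0 : ℝ) < p := by exact_mod_cast hp.pos
    rw [shiftDensity_apply, div_lt_one h2, shiftRoots_prime h hp]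
    norm_cast
    split_ifs with hd
    · exact hp.one_lt
    · refine lt_of_le_of_ne hp.two_le ?_
      rintro rfl
      exact hd hh.two_dvd

theorem mul_add_injective (h : ℕ) : Function.Injective fun n : ℕ => n * (n + h) := by
  refine StrictMono.injective fun m n hmn => ?_
  exact Nat.mul_lt_mul_of_lt_of_le hmn (by lia) (by lia)

theorem shiftSieve_abs_rem_le (h a M z : ℕ) (hh : Even h) {d : ℕ} (hd : d ≠ 0) :
    |(shiftSieve h a M z hh).rem d| ≤ d * (shiftSieve h a M z hh).nu d := by
  have h1 : (shiftSieve h a M z hh).multSum d =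
      (Finset.card {n ∈ Finset.Ico a (a + M) | d ∣ n * (n + h)} : ℕ) := by
    simp only [BoundingSieve.multSum, shiftSieve]
    rw [Finset.sum_image fun x _ y _ hxy => mul_add_injective h hxy, ← Finset.sum_filter]
    simp
  have h2 : (shiftSieve h a M z hh).nu = shiftDensity h := rfl
  have h3 : (shiftSieve h a M z hh).totalMass = M := rfl
  rw [BoundingSieve.rem, h1, h2, h3, mul_shiftDensity h hd]
  exact abs_card_Ico_dvd_sub_le a M h hd

/-- The condition `z < a` ensures that no prime counted here is among the sifting primes. -/
theorem card_prime_pairs_le_siftedSum (h a M z : ℕ) (hh : Even h) (hza : z < a) :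
    ((Finset.card {p ∈ Finset.Ico a (a + M) | p.Prime ∧ (p + h).Prime} : ℕ) : ℝ) ≤
      (shiftSieve h a M z hh).siftedSum := by
  have hs : (shiftSieve h a M z hh).siftedSum =
      ∑ d ∈ (Finset.Ico a (a + M)).image fun n => n * (n + h),
        if (primorial z).Coprime d then (1 : ℝ) else 0 := rfl
  rw [hs, Finset.sum_image fun x _ y _ hxy => mul_add_injective h hxy, ← Finset.sum_filter,
    Finset.sum_const, nsmul_one]
  norm_cast
  refine Finset.card_le_card fun p hp => ?_
  simp only [Finset.mem_filter, Finset.mem_Ico] at hp ⊢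
  have hcop : ∀ q, q.Prime → z < q → (primorial z).Coprime q := fun q hq hzq =>
    ((Nat.Prime.coprime_iff_not_dvd hq).2 fun hd => by
      have := hq.dvd_primorial_iff.1 hd
      lia).symm
  exact ⟨hp.1, (hcop p hp.2.1 (by lia)).mul_right (hcop _ hp.2.2 (by lia))⟩

theorem card_prime_pairs_le (h a M D : ℕ) (hh : Even h) (hD : 1 ≤ D) (hDa : D < a) :
    ((Finset.card {p ∈ Finset.Ico a (a + M) | p.Prime ∧ (p + h).Prime} : ℕ) : ℝ) ≤
      M / (shiftSieve h a M D hh).selbergSum D + (D : ℝ) ^ 4 := by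
  refine (card_prime_pairs_le_siftedSum h a M D hh hDa).trans ?_
  have hne : ∀ d, d ∣ (shiftSieve h a M D hh).prodPrimes → d ≠ 0 := fun d hd =>
    ne_zero_of_dvd_ne_zero BoundingSieve.prodPrimes_ne_zero hd
  refine BoundingSieve.siftedSum_le_div_selbergSum_add hD (fun d hd => ?_) fun d hd =>
    shiftSieve_abs_rem_le h a M D hh (hne d hd)
  have : (shiftSieve h a M D hh).nu = shiftDensity h := rfl
  rw [this, mul_shiftDensity h (hne d hd)]
  exact_mod_cast one_le_shiftRoots h (hne d hd)

theorem shiftSieve_selbergTerms (h a M z : ℕ) (hh : Even h) {l : ℕ} (hl : l ∣ primorial z) :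
    (shiftSieve h a M z hh).selbergTerms l =
      ∏ p ∈ l.primeFactors, if p ∣ h then ((p : ℝ) - 1)⁻¹ else 2 / ((p : ℝ) - 2) := by
  have hl' : l ∣ (shiftSieve h a M z hh).prodPrimes := hl
  rw [BoundingSieve.selbergTerms_apply, ← BoundingSieve.prod_primeFactors_nu hl',
    ← Finset.prod_mul_distrib]
  refine Finset.prod_congr rfl fun p hp => ?_
  have hp' := Nat.prime_of_mem_primeFactors hp
  have h1 := (shiftSieve h a M z hh).nu_lt_one_of_prime p hp'
    ((Nat.dvd_of_mem_primeFactors hp).trans hl)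
  have h2 : (shiftSieve h a M z hh).nu = shiftDensity h := rfl
  have hp0 : (0 : ℝ) < p := by exact_mod_cast hp'.pos
  rw [h2] at h1 ⊢
  rw [shiftDensity_apply, shiftRoots_prime h hp'] at h1 ⊢
  rw [div_lt_one hp0] at h1
  split_ifs at h1 ⊢ with hd
  · push_cast at h1 ⊢
    have h3 : (p : ℝ) - 1 ≠ 0 := by linarith
    field_simp
  · push_cast at h1 ⊢
    have h3 : (p : ℝ) - 2 ≠ 0 := by linarith
    field_simp

/-! ### Lower bound for the Selberg sum. -/

open ArithmeticFunction in
theorem ArithmeticFunction.prodPrimeFactors_nonneg {f : ℕ → ℝ} (hf : ∀ p, p.Prime → 0 ≤ f p) (n : ℕ) :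
    0 ≤ prodPrimeFactors f n := by
  rcases eq_or_ne n 0 with rfl | hn
  · simp
  · rw [prodPrimeFactors_apply hn]
    exact Finset.prod_nonneg fun p hp => hf p (Nat.prime_of_mem_primeFactors hp)

/-- The function `n ↦ ∏ 1 / (p - 1)`, the product being over the primes dividing `n`. -/
noncomputable def invPredProd : ArithmeticFunction ℝ :=
  ArithmeticFunction.prodPrimeFactors fun p => ((p : ℝ) - 1)⁻¹

theorem invPredProd_isMultiplicative : invPredProd.IsMultiplicative :=
  ArithmeticFunction.IsMultiplicative.prodPrimeFactors _

theorem inv_pred_nonneg {p : ℕ} (hp : p.Prime) : 0 ≤ ((p : ℝ) - 1)⁻¹ := by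
  have : (1 : ℝ) < p := by exact_mod_cast hp.one_lt
  exact inv_nonneg.2 (by linarith)

theorem invPredProd_nonneg (n : ℕ) : 0 ≤ invPredProd n :=
  ArithmeticFunction.prodPrimeFactors_nonneg (fun _ hp => inv_pred_nonneg hp) n

theorem invPredProd_prime {p : ℕ} (hp : p.Prime) : invPredProd p = ((p : ℝ) - 1)⁻¹ := by
  rw [invPredProd, ArithmeticFunction.prodPrimeFactors_apply hp.ne_zero, hp.primeFactors,
    Finset.prod_singleton]

theorem Nat.squarefree_prod_primeFactors (n : ℕ) : Squarefree (∏ p ∈ n.primeFactors, p) := by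
  refine Finset.squarefree_prod_of_pairwise_isCoprime (fun p hp q hq hpq => ?_) fun p hp =>
    (Nat.prime_of_mem_primeFactors hp).prime.squarefree
  exact Nat.coprime_iff_isRelPrime.1 ((Nat.coprime_primes (Nat.prime_of_mem_primeFactors hp)
    (Nat.prime_of_mem_primeFactors hq)).2 hpq)

/-- For squarefree `l`, write `n = l m` with `m` composed only of primes dividing `l`; the geometric
series give `∏ p⁻¹ (1 - p⁻¹)⁻¹ = ∏ (p - 1)⁻¹`. For other `l` the sum is empty. -/
theorem sum_inv_of_radical_eq_le (D l : ℕ) :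
    ∑ n ∈ Finset.Icc 1 D with ∏ p ∈ n.primeFactors, p = l, (n : ℝ)⁻¹ ≤ invPredProd l := by
  rcases eq_or_ne l 0 with rfl | hl0
  · refine (Finset.sum_eq_zero fun n hn => ?_).le.trans (invPredProd_nonneg 0)
    have := (Finset.mem_filter.1 hn).2
    rw [Finset.prod_eq_zero_iff] at this
    obtain ⟨p, hp, rfl⟩ := this
    exact absurd (Nat.prime_of_mem_primeFactors hp) Nat.not_prime_zero
  by_cases hsq : l = ∏ p ∈ l.primeFactors, p
  swap
  · refine (Finset.sum_eq_zero fun n hn => ?_).le.trans (invPredProd_nonneg l)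
    refine absurd ?_ hsq
    have h1 := (Finset.mem_filter.1 hn).2
    rw [← h1, Nat.primeFactors_prod fun p hp => Nat.prime_of_mem_primeFactors hp]
  let f : ℕ →* ℝ :=
    { toFun := fun n => (n : ℝ)⁻¹
      map_one' := by simp
      map_mul' := fun m n => by push_cast; rw [mul_inv] }
  have hf : ∀ {p : ℕ}, p.Prime → ‖f p‖ < 1 := fun {p} hp => by
    have : (1 : ℝ) < p := by exact_mod_cast hp.one_lt
    simp only [f, MonoidHom.coe_mk, OneHom.coe_mk, norm_inv, RCLike.norm_natCast]
    exact inv_lt_one_of_one_lt₀ this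
  have hs := (EulerProduct.summable_and_hasSum_factoredNumbers_prod_filter_prime_geometric hf
    l.primeFactors).2
  have hfil : {p ∈ l.primeFactors | p.Prime} = l.primeFactors :=
    Finset.filter_true_of_mem fun p hp => Nat.prime_of_mem_primeFactors hp
  rw [hfil] at hs
  have hs' := hasSum_subtype_iff_indicator.1 hs
  have hlpos : (0 : ℝ) < l := by exact_mod_cast Nat.pos_of_ne_zero hl0
  have hdvd : ∀ n ∈ {n ∈ Finset.Icc 1 D | ∏ p ∈ n.primeFactors, p = l},
      l * (n / l) = n ∧ n / l ∈ Nat.factoredNumbers l.primeFactors := fun n hn => by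
    obtain ⟨h1, h2⟩ := Finset.mem_filter.1 hn
    have h3 : l ∣ n := h2 ▸ Nat.prod_primeFactors_dvd n
    have h4 : l * (n / l) = n := Nat.mul_div_cancel' h3
    have hn0 : n ≠ 0 := by have := (Finset.mem_Icc.1 h1).1; lia
    refine ⟨h4, ?_⟩
    rw [Nat.mem_factoredNumbers_iff_primeFactors_subset]
    have h5 : n.primeFactors = l.primeFactors := by
      rw [← h2, Nat.primeFactors_prod fun p hp => Nat.prime_of_mem_primeFactors hp]
    refine ⟨fun h => hn0 (by rw [← h4, h, mul_zero]), ?_⟩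
    rw [← h5]
    exact Nat.primeFactors_mono (Nat.div_dvd_of_dvd h3) hn0
  have hval : invPredProd l = (l : ℝ)⁻¹ * ∏ p ∈ l.primeFactors, (1 - f p)⁻¹ := by
    rw [invPredProd, ArithmeticFunction.prodPrimeFactors_apply hl0]
    conv_rhs => rw [hsq]
    push_cast
    rw [← hsq, ← Finset.prod_inv_distrib, ← Finset.prod_mul_distrib]
    refine Finset.prod_congr rfl fun p hp => ?_
    have : (1 : ℝ) < p := by exact_mod_cast (Nat.prime_of_mem_primeFactors hp).one_lt
    have h1 : (p : ℝ) - 1 ≠ 0 := by linarith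
    simp only [f, MonoidHom.coe_mk, OneHom.coe_mk]
    rw [← mul_inv, mul_sub, mul_one, mul_inv_cancel₀ (by linarith)]
  rw [hval]
  have hinj : Set.InjOn (fun n => n / l)
      ({n ∈ Finset.Icc 1 D | ∏ p ∈ n.primeFactors, p = l} : Finset ℕ) :=
    fun m hm n hn hmn => by
      rw [← (hdvd m hm).1, ← (hdvd n hn).1]
      exact congrArg (l * ·) hmn
  calc _ = (l : ℝ)⁻¹ * ∑ m ∈ {n ∈ Finset.Icc 1 D | ∏ p ∈ n.primeFactors, p = l}.image (· / l),
        (Nat.factoredNumbers l.primeFactors).indicator f m := by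
        rw [Finset.sum_image hinj, Finset.mul_sum]
        refine Finset.sum_congr rfl fun n hn => ?_
        rw [Set.indicator_of_mem (hdvd n hn).2]
        conv_lhs => rw [← (hdvd n hn).1]
        push_cast
        rw [mul_inv]
        rfl
    _ ≤ _ := by
        refine mul_le_mul_of_nonneg_left (sum_le_hasSum _ (fun m _ => ?_) hs') (by positivity)
        exact Set.indicator_nonneg (fun m _ => by simp [f]) m

theorem sum_inv_le_sum_invPredProd (D : ℕ) :
    ∑ n ∈ Finset.Icc 1 D, (n : ℝ)⁻¹ ≤ ∑ l ∈ Finset.Icc 1 D with Squarefree l, invPredProd l := by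
  rw [← Finset.sum_fiberwise_of_maps_to (s := Finset.Icc 1 D)
    (t := {l ∈ Finset.Icc 1 D | Squarefree l}) (g := fun n => ∏ p ∈ n.primeFactors, p)]
  · exact Finset.sum_le_sum fun l _ => sum_inv_of_radical_eq_le D l
  · intro n hn
    obtain ⟨h1, h2⟩ := Finset.mem_Icc.1 hn
    refine Finset.mem_filter.2 ⟨Finset.mem_Icc.2 ⟨?_, ?_⟩, n.squarefree_prod_primeFactors⟩
    · exact Finset.prod_pos fun p hp => (Nat.prime_of_mem_primeFactors hp).pos
    · exact (Nat.le_of_dvd h1 (Nat.prod_primeFactors_dvd n)).trans h2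

/-- Factor `a = gcd(a, k) · b` with `b` coprime to `k`. The map `a ↦ (gcd(a, k), b)` is injective,
and summing `invPredProd` over the divisors of `k` gives `∏ (1 + 1/(p-1)) = ∏ (1 - 1/p)⁻¹`. -/
theorem sum_invPredProd_le_mul (D : ℕ) {k : ℕ} (hk : Squarefree k) :
    ∑ a ∈ Finset.Icc 1 D with Squarefree a, invPredProd a ≤
      (∏ p ∈ k.primeFactors, (1 - (p : ℝ)⁻¹)⁻¹) *
        ∑ b ∈ Finset.Icc 1 D with Squarefree b ∧ b.Coprime k, invPredProd b := by
  have h1 : ∏ p ∈ k.primeFactors, (1 - (p : ℝ)⁻¹)⁻¹ = ∑ d ∈ k.divisors, invPredProd d := by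
    rw [← invPredProd_isMultiplicative.prodPrimeFactors_one_add_of_squarefree hk]
    refine Finset.prod_congr rfl fun p hp => ?_
    have hp' := Nat.prime_of_mem_primeFactors hp
    have : (1 : ℝ) < p := by exact_mod_cast hp'.one_lt
    have h1 : (p : ℝ) - 1 ≠ 0 := by linarith
    rw [invPredProd_prime hp']
    field_simp
    ring
  rw [h1, Finset.sum_mul_sum, ← Finset.sum_product']
  have hmul : ∀ a ∈ {a ∈ Finset.Icc 1 D | Squarefree a},
      invPredProd a = invPredProd (a.gcd k) * invPredProd (a / a.gcd k) := fun a ha => by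
    have hsq := (Finset.mem_filter.1 ha).2
    have h2 : a.gcd k * (a / a.gcd k) = a := Nat.mul_div_cancel' (Nat.gcd_dvd_left a k)
    rw [← invPredProd_isMultiplicative.map_mul_of_coprime, h2]
    exact ((Nat.coprime_div_gcd_of_squarefree hsq hk.ne_zero).coprime_dvd_right (Nat.gcd_dvd_right a k)).symm
  rw [Finset.sum_congr rfl hmul]
  have hinj : Set.InjOn (fun a : ℕ => (a.gcd k, a / a.gcd k))
      ({a ∈ Finset.Icc 1 D | Squarefree a} : Finset ℕ) := fun a _ b _ hab => by
    obtain ⟨h2, h3⟩ := Prod.ext_iff.1 hab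
    simp only at h2 h3
    rw [← Nat.mul_div_cancel' (Nat.gcd_dvd_left a k), ← Nat.mul_div_cancel' (Nat.gcd_dvd_left b k),
      h3, h2]
  rw [← Finset.sum_image (f := fun x : ℕ × ℕ => invPredProd x.1 * invPredProd x.2) hinj]
  refine Finset.sum_le_sum_of_subset_of_nonneg (fun x hx => ?_) fun x _ _ =>
    mul_nonneg (invPredProd_nonneg _) (invPredProd_nonneg _)
  obtain ⟨a, ha, rfl⟩ := Finset.mem_image.1 hx
  obtain ⟨h2, hsq⟩ := Finset.mem_filter.1 ha
  obtain ⟨h3, h4⟩ := Finset.mem_Icc.1 h2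
  have hdvd : a / a.gcd k ∣ a := Nat.div_dvd_of_dvd (Nat.gcd_dvd_left a k)
  simp only [Finset.mem_product, Nat.mem_divisors, Finset.mem_filter, Finset.mem_Icc]
  exact ⟨⟨Nat.gcd_dvd_right a k, hk.ne_zero⟩,
    ⟨Nat.pos_of_dvd_of_pos hdvd h3, (Nat.le_of_dvd h3 hdvd).trans h4⟩,
    hsq.squarefree_of_dvd hdvd, Nat.coprime_div_gcd_of_squarefree hsq hk.ne_zero⟩

/-- The restriction of `invPredProd` to integers coprime to `k`. -/
noncomputable def coprimeInvPredProd (k : ℕ) : ArithmeticFunction ℝ :=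
  ArithmeticFunction.prodPrimeFactors fun p => if p ∣ k then 0 else ((p : ℝ) - 1)⁻¹

theorem coprimeInvPredProd_nonneg (k n : ℕ) : 0 ≤ coprimeInvPredProd k n :=
  ArithmeticFunction.prodPrimeFactors_nonneg (fun p hp => by
    split_ifs
    · exact le_rfl
    · exact inv_pred_nonneg hp) n

theorem coprimeInvPredProd_of_coprime {k n : ℕ} (hn : n ≠ 0) (h : n.Coprime k) :
    coprimeInvPredProd k n = invPredProd n := by
  rw [coprimeInvPredProd, invPredProd, ArithmeticFunction.prodPrimeFactors_apply hn,
    ArithmeticFunction.prodPrimeFactors_apply hn]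
  refine Finset.prod_congr rfl fun p hp => if_neg fun hpk => ?_
  exact (Nat.prime_of_mem_primeFactors hp).one_lt.ne'
    (Nat.eq_one_of_dvd_coprimes h (Nat.dvd_of_mem_primeFactors hp) hpk)

/-- The triples encode pairs `(a, b)` with `lcm(a, b) = l`, where `c = gcd(a, b)` and `a = c · (l /
b)`. The local factor at `p` adds the case `p ∣ b`, with or without `p ∣ c`, to the case `p ∤ b`. -/
theorem sum_divisors_triple_eq_prod {k l : ℕ} (hl : Squarefree l) :
    ∑ b ∈ l.divisors, ∑ c ∈ b.divisors,
      coprimeInvPredProd k b * (invPredProd c * invPredProd (l / b)) =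
    ∏ p ∈ l.primeFactors, ((if p ∣ k then 0 else ((p : ℝ) - 1)⁻¹ * (1 + ((p : ℝ) - 1)⁻¹)) +
      ((p : ℝ) - 1)⁻¹) := by
  let E : ArithmeticFunction ℝ := ArithmeticFunction.prodPrimeFactors fun p =>
    if p ∣ k then 0 else ((p : ℝ) - 1)⁻¹ * (1 + ((p : ℝ) - 1)⁻¹)
  have hE : E.IsMultiplicative := ArithmeticFunction.IsMultiplicative.prodPrimeFactors _
  have h1 := hE.prodPrimeFactors_add_of_squarefree invPredProd_isMultiplicative hl
  rw [ArithmeticFunction.prodPrimeFactors_apply hl.ne_zero, ArithmeticFunction.mul_apply,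
    Nat.sum_divisorsAntidiagonal fun b c => E b * invPredProd c] at h1
  have h2 : ∀ p ∈ l.primeFactors, (E + invPredProd) p =
      (if p ∣ k then 0 else ((p : ℝ) - 1)⁻¹ * (1 + ((p : ℝ) - 1)⁻¹)) + ((p : ℝ) - 1)⁻¹ :=
    fun p hp => by
      have hp' := Nat.prime_of_mem_primeFactors hp
      rw [ArithmeticFunction.add_apply, invPredProd_prime hp']
      simp only [E]
      rw [ArithmeticFunction.prodPrimeFactors_apply hp'.ne_zero, hp'.primeFactors,
        Finset.prod_singleton]
  rw [← Finset.prod_congr rfl h2, h1]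
  refine Finset.sum_congr rfl fun b hb => ?_
  have hbsq : Squarefree b := hl.squarefree_of_dvd (Nat.dvd_of_mem_divisors hb)
  rw [← Finset.mul_sum, ← Finset.sum_mul, ← mul_assoc]
  congr 1
  rw [← invPredProd_isMultiplicative.prodPrimeFactors_one_add_of_squarefree hbsq]
  simp only [E, coprimeInvPredProd]
  rw [ArithmeticFunction.prodPrimeFactors_apply hbsq.ne_zero,
    ArithmeticFunction.prodPrimeFactors_apply hbsq.ne_zero, ← Finset.prod_mul_distrib]
  refine Finset.prod_congr rfl fun p hp => ?_
  rw [invPredProd_prime (Nat.prime_of_mem_primeFactors hp)]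
  split_ifs <;> simp

/-- Group the pairs by their least common multiple, which is at most `D * D`; this is why the sieve
is later run at level `D * D`. A pair is recovered from its lcm, its gcd and `b`. -/
theorem sum_mul_sum_invPredProd_le (D k : ℕ) :
    (∑ a ∈ Finset.Icc 1 D with Squarefree a, invPredProd a) *
      (∑ b ∈ Finset.Icc 1 D with Squarefree b ∧ b.Coprime k, invPredProd b) ≤
    ∑ l ∈ Finset.Icc 1 (D * D) with Squarefree l,
      ∏ p ∈ l.primeFactors, ((if p ∣ k then 0 else ((p : ℝ) - 1)⁻¹ * (1 + ((p : ℝ) - 1)⁻¹)) +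
        ((p : ℝ) - 1)⁻¹) := by
  let F : (_ : ℕ) × (_ : ℕ) × ℕ → ℝ := fun x =>
    coprimeInvPredProd k x.2.1 * (invPredProd x.2.2 * invPredProd (x.1 / x.2.1))
  have hR : ∑ l ∈ Finset.Icc 1 (D * D) with Squarefree l,
      ∏ p ∈ l.primeFactors, ((if p ∣ k then 0 else ((p : ℝ) - 1)⁻¹ * (1 + ((p : ℝ) - 1)⁻¹)) +
        ((p : ℝ) - 1)⁻¹) =
      ∑ x ∈ Finset.sigma {l ∈ Finset.Icc 1 (D * D) | Squarefree l}
        (fun l => Finset.sigma l.divisors fun b => b.divisors), F x := by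
    rw [Finset.sum_sigma]
    refine Finset.sum_congr rfl fun l hl => ?_
    rw [← sum_divisors_triple_eq_prod (Finset.mem_filter.1 hl).2, Finset.sum_sigma]
  rw [hR, Finset.sum_mul_sum, ← Finset.sum_product']
  set T := {a ∈ Finset.Icc 1 D | Squarefree a} ×ˢ
    {b ∈ Finset.Icc 1 D | Squarefree b ∧ b.Coprime k}
  have hT : ∀ x ∈ T, x.1 ≠ 0 ∧ x.2 ≠ 0 ∧ x.1 ≤ D ∧ x.2 ≤ D ∧ Squarefree x.1 ∧ Squarefree x.2 ∧
      x.2.Coprime k := fun x hx => by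
    simp only [T, Finset.mem_product, Finset.mem_filter, Finset.mem_Icc] at hx
    exact ⟨by lia, by lia, hx.1.1.2, hx.2.1.2, hx.1.2, hx.2.2.1, hx.2.2.2⟩
  have hlcm : ∀ x ∈ T, x.1.lcm x.2 = x.1 / x.1.gcd x.2 * x.2 := fun x hx => by
    refine Nat.eq_of_mul_eq_mul_left (Nat.gcd_pos_of_pos_left x.2
      (Nat.pos_of_ne_zero (hT x hx).1)) ?_
    rw [Nat.gcd_mul_lcm, ← mul_assoc, Nat.mul_div_cancel' (Nat.gcd_dvd_left _ _)]
  let i : ℕ × ℕ → (_ : ℕ) × (_ : ℕ) × ℕ := fun x => ⟨x.1.lcm x.2, x.2, x.1.gcd x.2⟩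
  have hval : ∀ x ∈ T, invPredProd x.1 * invPredProd x.2 = F (i x) := fun x hx => by
    obtain ⟨h1, h2, -, -, h3, h4, h5⟩ := hT x hx
    have hcop := Nat.coprime_div_gcd_of_squarefree h3 h2
    simp only [F, i]
    rw [hlcm x hx, Nat.mul_div_cancel _ (Nat.pos_of_ne_zero h2),
      ← invPredProd_isMultiplicative.map_mul_of_coprime
        (hcop.coprime_dvd_right (Nat.gcd_dvd_right _ _)).symm,
      Nat.mul_div_cancel' (Nat.gcd_dvd_left _ _), coprimeInvPredProd_of_coprime h2 h5, mul_comm]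
  have hinj : Set.InjOn i T := fun x hx y hy hxy => by
    simp only [i, Sigma.mk.injEq, heq_eq_eq] at hxy
    obtain ⟨h1, h2, h3⟩ := hxy
    have h4 := Nat.gcd_mul_lcm x.1 x.2
    rw [h3, h1, Nat.gcd_mul_lcm, h2] at h4
    exact Prod.ext (Nat.eq_of_mul_eq_mul_right (Nat.pos_of_ne_zero (hT y hy).2.1) h4).symm h2
  rw [Finset.sum_congr rfl hval, ← Finset.sum_image (f := F) hinj]
  refine Finset.sum_le_sum_of_subset_of_nonneg (fun z hz => ?_) fun z _ _ =>
    mul_nonneg (coprimeInvPredProd_nonneg _ _) (mul_nonneg (invPredProd_nonneg _)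
      (invPredProd_nonneg _))
  obtain ⟨x, hx, rfl⟩ := Finset.mem_image.1 hz
  obtain ⟨h1, h2, h3, h4, h5, h6, h7⟩ := hT x hx
  have hcop := Nat.coprime_div_gcd_of_squarefree h5 h2
  have hl0 : x.1.lcm x.2 ≠ 0 := Nat.lcm_ne_zero h1 h2
  simp only [i, Finset.mem_sigma, Finset.mem_filter, Finset.mem_Icc, Nat.mem_divisors]
  refine ⟨⟨⟨Nat.pos_of_ne_zero hl0, ?_⟩, ?_⟩, ⟨Nat.dvd_lcm_right _ _, hl0⟩,
    Nat.gcd_dvd_right _ _, h2⟩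
  · exact (Nat.le_of_dvd (Nat.pos_of_ne_zero (Nat.mul_ne_zero h1 h2)) (Nat.lcm_dvd_mul _ _)).trans
      (Nat.mul_le_mul h3 h4)
  · rw [hlcm x hx, Nat.squarefree_mul hcop]
    exact ⟨h5.squarefree_of_dvd (Nat.div_dvd_of_dvd (Nat.gcd_dvd_left _ _)), h6⟩

theorem log_le_sum_invPredProd (D : ℕ) :
    Real.log (D + 1) ≤ ∑ a ∈ Finset.Icc 1 D with Squarefree a, invPredProd a := by
  refine le_trans ?_ (sum_inv_le_sum_invPredProd D)
  have := log_add_one_le_harmonic D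
  rw [harmonic_eq_sum_Icc] at this
  push_cast at this
  exact this

/-- Two copies of the sum of `invPredProd`, each at least `log (D + 1)`, produce the squared
logarithm; making one coprime to `h` costs the product over `p ∣ h`. The local factors of the result
are at most the Selberg terms: equal for `p ∣ h`, and `(2p - 1)/(p - 1)² ≤ 2/(p - 2)` otherwise. -/
theorem log_sq_le_mul_selbergSum (h a M D : ℕ) (hh : Even h) (h0 : h ≠ 0) :
    Real.log (D + 1) ^ 2 ≤ (∏ p ∈ h.primeFactors, (1 - (p : ℝ)⁻¹)⁻¹) *
      (shiftSieve h a M (D * D) hh).selbergSum (D * D) := by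
  set k := ∏ p ∈ h.primeFactors, p
  have hk : Squarefree k := h.squarefree_prod_primeFactors
  have hkp : k.primeFactors = h.primeFactors :=
    Nat.primeFactors_prod fun p hp => Nat.prime_of_mem_primeFactors hp
  have hdvd : ∀ p, p.Prime → (p ∣ k ↔ p ∣ h) := fun p hp => by
    have := congrArg (p ∈ ·) hkp
    simpa [hp, hk.ne_zero, h0] using this
  have h1 := log_le_sum_invPredProd D
  have h2 := sum_invPredProd_le_mul D hk
  have h3 := sum_mul_sum_invPredProd_le D k
  have hg : ∑ l ∈ Finset.Icc 1 (D * D) with Squarefree l,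
      ∏ p ∈ l.primeFactors, ((if p ∣ k then 0 else ((p : ℝ) - 1)⁻¹ * (1 + ((p : ℝ) - 1)⁻¹)) +
        ((p : ℝ) - 1)⁻¹) ≤ (shiftSieve h a M (D * D) hh).selbergSum (D * D) := by
    have hset : {l ∈ Finset.Icc 1 (D * D) | Squarefree l} =
        {l ∈ (primorial (D * D)).divisors | l ≤ D * D} := by
      ext l
      simp only [Finset.mem_filter, Finset.mem_Icc, Nat.mem_divisors]
      constructor
      · rintro ⟨⟨h4, h5⟩, h6⟩
        exact ⟨⟨h6.dvd_primorial.trans (primorial_dvd_primorial h5), primorial_ne_zero _⟩, h5⟩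
      · rintro ⟨⟨h4, h5⟩, h6⟩
        exact ⟨⟨Nat.pos_of_dvd_of_pos h4 (primorial_pos _), h6⟩,
          (squarefree_primorial _).squarefree_of_dvd h4⟩
    have hS : (shiftSieve h a M (D * D) hh).selbergSum (D * D) =
      ∑ l ∈ (primorial (D * D)).divisors with l ≤ D * D,
        (shiftSieve h a M (D * D) hh).selbergTerms l := rfl
    rw [hset, hS]
    refine Finset.sum_le_sum fun l hl => ?_
    rw [shiftSieve_selbergTerms h a M _ hh (Nat.dvd_of_mem_divisors (Finset.mem_filter.1 hl).1)]
    refine Finset.prod_le_prod (fun p hp => ?_) fun p hp => ?_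
    · have := inv_pred_nonneg (Nat.prime_of_mem_primeFactors hp)
      split_ifs <;> positivity
    · have hp' := Nat.prime_of_mem_primeFactors hp
      simp only [hdvd p hp']
      split_ifs with hph
      · simp
      · have hp3 : 3 ≤ p := by
          refine lt_of_le_of_ne hp'.two_le ?_
          rintro rfl
          exact hph hh.two_dvd
        have hp3' : (3 : ℝ) ≤ p := by exact_mod_cast hp3
        have e1 : (0 : ℝ) < p - 1 := by linarith
        have e2 : (0 : ℝ) < p - 2 := by linarith
        have e3 : ((p : ℝ) - 1)⁻¹ * (1 + ((p : ℝ) - 1)⁻¹) + ((p : ℝ) - 1)⁻¹ =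
            (2 * p - 1) / ((p : ℝ) - 1) ^ 2 := by
          field_simp
          ring
        rw [e3, div_le_div_iff₀ (by positivity) e2]
        nlinarith
  rw [hkp] at h2
  have hlog : 0 ≤ Real.log ((D : ℝ) + 1) := Real.log_nonneg (by
    have : (0 : ℝ) ≤ D := Nat.cast_nonneg D
    linarith)
  set S1 := ∑ a ∈ Finset.Icc 1 D with Squarefree a, invPredProd a
  set S2 := ∑ b ∈ Finset.Icc 1 D with Squarefree b ∧ b.Coprime k, invPredProd b
  set Q := ∏ p ∈ h.primeFactors, (1 - (p : ℝ)⁻¹)⁻¹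
  have hQ : 0 ≤ Q := Finset.prod_nonneg fun p hp => by
    have : (1 : ℝ) ≤ p := by exact_mod_cast (Nat.prime_of_mem_primeFactors hp).one_lt.le
    exact inv_nonneg.2 (sub_nonneg.2 (inv_le_one_of_one_le₀ this))
  calc Real.log (D + 1) ^ 2 ≤ S1 * S1 := by rw [sq]; exact mul_le_mul h1 h1 hlog (hlog.trans h1)
    _ ≤ S1 * (Q * S2) := mul_le_mul_of_nonneg_left h2 (hlog.trans h1)
    _ = Q * (S1 * S2) := by ring
    _ ≤ _ := mul_le_mul_of_nonneg_left (h3.trans hg) hQ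

/-! ### Gap frequencies and the bound for `w_X`. -/

theorem collisionProb_le {α : Type*} (ν : PMF α) {B : ℝ} (hB : ∀ z, (ν z).toReal ≤ B) :
    collisionProb ν ≤ B := by
  have hs : Summable fun z => (ν z).toReal :=
    ENNReal.summable_toReal (by rw [ν.tsum_coe]; exact ENNReal.one_ne_top)
  have h1 : ∑' z, (ν z).toReal = 1 := by
    rw [← ENNReal.tsum_toReal_eq ν.apply_ne_top, ν.tsum_coe, ENNReal.toReal_one]
  calc collisionProb ν ≤ ∑' z, B * (ν z).toReal := by
        refine (summable_collisionProb ν).tsum_le_tsum (fun z => ?_) (hs.mul_left B)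
        rw [sq]
        exact mul_le_mul_of_nonneg_right (hB z) ENNReal.toReal_nonneg
    _ = B := by rw [tsum_mul_left, h1, mul_one]

theorem collisionProb_nonneg {α : Type*} (ν : PMF α) : 0 ≤ collisionProb ν :=
  tsum_nonneg fun _ => sq_nonneg _

theorem collisionProb_le_one {α : Type*} (ν : PMF α) : collisionProb ν ≤ 1 :=
  collisionProb_le ν fun z => by
    simpa using ENNReal.toReal_mono ENNReal.one_ne_top (ν.coe_le_one z)

theorem gapLaw_toReal (X : ℝ) (hX : 2 ≤ X) (h : ℕ) :
    (gapLaw X hX h).toReal =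
      (Finset.card {p ∈ dyadicPrimes X | primeGap p = h} : ℝ) / (dyadicPrimes X).card := by
  rw [gapLaw, PMF.map_apply, tsum_eq_sum (s := dyadicPrimes X)]
  · refine (congrArg ENNReal.toReal (Finset.sum_congr rfl
      (g := fun p => if primeGap p = h then ((dyadicPrimes X).card : ENNReal)⁻¹ else 0)
      fun p hp => ?_)).trans ?_
    · rw [PMF.uniformOfFinset_apply, if_pos hp]
      by_cases hph : primeGap p = h
      · rw [if_pos hph, if_pos hph.symm]
      · rw [if_neg hph, if_neg (Ne.symm hph)]
    · rw [← Finset.sum_filter, Finset.sum_const, nsmul_eq_mul, ENNReal.toReal_mul,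
        ENNReal.toReal_inv, div_eq_mul_inv]
      simp
  · intro p hp
    simp [PMF.uniformOfFinset_apply, hp]

theorem add_primeGap (p : ℕ) : p + primeGap p = nextPrime p :=
  Nat.add_sub_cancel' (nextPrime_spec p).2.le

theorem primeGap_le {p : ℕ} (hp : p ≠ 0) : primeGap p ≤ p := by
  obtain ⟨q, hq, h1, h2⟩ := Nat.exists_prime_lt_and_le_two_mul p hp
  have h3 : nextPrime p ≤ q := Nat.sInf_le ⟨hq, h1⟩
  have := add_primeGap p
  lia

theorem even_primeGap {p : ℕ} (hp : p.Prime) (h2 : p ≠ 2) : Even (primeGap p) := by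
  obtain ⟨h3, h4⟩ := nextPrime_spec p
  exact Nat.Odd.sub_odd (h3.odd_of_ne_two (by have := hp.two_le; lia)) (hp.odd_of_ne_two h2)

theorem card_primeGap_eq_le {X : ℝ} (hX2 : 2 < X) (hX : Real.exp 3 ≤ 3 * X) (h : ℕ) :
    (Finset.card {p ∈ dyadicPrimes X | primeGap p = h} : ℝ) ≤
      1024 * Real.exp 10 * (X * Real.log (Real.log (3 * X)) / Real.log X ^ 2) + √X := by
  have hlogX : 0 < Real.log X := Real.log_pos (by linarith)
  have hl3 : 3 ≤ Real.log (3 * X) := (Real.le_log_iff_exp_le (by linarith)).2 hX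
  have hll : 0 < Real.log (Real.log (3 * X)) := Real.log_pos (by linarith)
  -- If the set is nonempty, `h` is an actual gap, hence positive, at most `2X` by Bertrand, and
  -- even because `X > 2` excludes `p = 2`.
  rcases Finset.eq_empty_or_nonempty {p ∈ dyadicPrimes X | primeGap p = h} with he | ⟨p₀, hp₀⟩
  · rw [he, Finset.card_empty, Nat.cast_zero]
    positivity
  obtain ⟨hp1, rfl⟩ := Finset.mem_filter.1 hp₀
  obtain ⟨hp2, hp3, hp4⟩ := (mem_dyadicPrimes hX2.le p₀).1 hp1
  set h := primeGap p₀
  have hh : Even h := even_primeGap hp2 (by rintro rfl; norm_num at hp3; linarith)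
  have h0 : h ≠ 0 := (Nat.sub_pos_of_lt (nextPrime_spec p₀).2).ne'
  have hhX : (h : ℝ) ≤ 3 * X := by
    have : (h : ℝ) ≤ p₀ := by exact_mod_cast primeGap_le hp2.ne_zero
    linarith
  -- The sieve level is `E * E`, so the error `(E * E) ^ 4 = E ^ 8` is at most `√X`.
  set E := ⌊X ^ (1 / 16 : ℝ)⌋₊
  have hX1 : (1 : ℝ) ≤ X ^ (1 / 16 : ℝ) := Real.one_le_rpow (by linarith) (by norm_num)
  have hE1 : 1 ≤ E := Nat.le_floor (by exact_mod_cast hX1)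
  have hEle : (E : ℝ) ≤ X ^ (1 / 16 : ℝ) := Nat.floor_le (by positivity)
  have hElt : X ^ (1 / 16 : ℝ) < E + 1 := Nat.lt_floor_add_one _
  have hpow : (X ^ (1 / 16 : ℝ)) ^ 8 = √X := by
    rw [← Real.rpow_natCast, ← Real.rpow_mul (by linarith), Real.sqrt_eq_rpow]
    norm_num
  have hE8 : ((E * E : ℕ) : ℝ) ^ 4 ≤ √X := by
    rw [← hpow]
    push_cast
    calc ((E : ℝ) * E) ^ 4 = (E : ℝ) ^ 8 := by ring
      _ ≤ _ := pow_le_pow_left₀ (by positivity) hEle 8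
  have hsX : √X < X := by
    rw [Real.sqrt_lt' (by linarith)]
    nlinarith
  have hEE : ((E * E : ℕ) : ℝ) < X := by
    refine lt_of_le_of_lt ?_ (hE8.trans_lt hsX)
    have : (1 : ℝ) ≤ ((E * E : ℕ) : ℝ) := by exact_mod_cast Nat.mul_pos hE1 hE1
    exact le_self_pow₀ this (by norm_num)
  have hEa : E * E < ⌈X⌉₊ := Nat.lt_ceil.2 hEE
  -- The `+ 1` makes `M > X`, so that `⌈X⌉₊ + M` exceeds `2X`.
  set M := ⌊X⌋₊ + 1
  have hM : (M : ℝ) ≤ 2 * X := by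
    have := Nat.floor_le (show 0 ≤ X by linarith)
    simp only [M]
    push_cast
    linarith
  have hcard : Finset.card {p ∈ dyadicPrimes X | primeGap p = h} ≤
      Finset.card {p ∈ Finset.Ico ⌈X⌉₊ (⌈X⌉₊ + M) | p.Prime ∧ (p + h).Prime} := by
    refine Finset.card_le_card fun p hp => ?_
    obtain ⟨h1, h2⟩ := Finset.mem_filter.1 hp
    obtain ⟨h3, h4, h5⟩ := (mem_dyadicPrimes hX2.le p).1 h1
    simp only [Finset.mem_filter, Finset.mem_Ico]
    refine ⟨⟨Nat.ceil_le.2 h4, ?_⟩, h3, ?_⟩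
    · have h6 : (p : ℝ) < ((⌈X⌉₊ + M : ℕ) : ℝ) := by
        have h7 := Nat.le_ceil X
        have h8 := Nat.lt_floor_add_one X
        simp only [M]
        push_cast
        linarith
      exact_mod_cast h6
    · rw [← h2, add_primeGap]
      exact (nextPrime_spec p).1
  have hsieve := card_prime_pairs_le h ⌈X⌉₊ M (E * E) hh (Nat.mul_pos hE1 hE1) hEa
  have hS := log_sq_le_mul_selbergSum h ⌈X⌉₊ M E hh h0
  have hSpos := BoundingSieve.selbergSum_pos (s := shiftSieve h ⌈X⌉₊ M (E * E) hh)
    (D := E * E) (Nat.mul_pos hE1 hE1)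
  have hQ := prod_primeFactors_inv_one_sub_inv_le h0 hX hhX
  set S := (shiftSieve h ⌈X⌉₊ M (E * E) hh).selbergSum (E * E)
  set Q := ∏ p ∈ h.primeFactors, (1 - (p : ℝ)⁻¹)⁻¹
  have hlogE : Real.log X / 16 ≤ Real.log (E + 1) := by
    have : Real.log (X ^ (1 / 16 : ℝ)) ≤ Real.log (E + 1) :=
      Real.log_le_log (by positivity) hElt.le
    rw [Real.log_rpow (by linarith)] at this
    linarith
  have hS2 : (Real.log X / 16) ^ 2 ≤ 2 * Real.exp 10 * Real.log (Real.log (3 * X)) * S :=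
    ((pow_le_pow_left₀ (by positivity) hlogE 2).trans hS).trans
      (mul_le_mul_of_nonneg_right hQ hSpos.le)
  have hmain : (M : ℝ) / S ≤
      1024 * Real.exp 10 * (X * Real.log (Real.log (3 * X)) / Real.log X ^ 2) := by
    rw [← mul_div_assoc, div_le_div_iff₀ hSpos (by positivity)]
    -- Here `512 = 2 · 16²`, from `log (E + 1) ≥ log X / 16`; the bound `M ≤ 2X` doubles it to
    -- `1024`.
    have h1 : Real.log X ^ 2 ≤ 512 * Real.exp 10 * Real.log (Real.log (3 * X)) * S := by
      rw [div_pow] at hS2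
      linarith
    calc (M : ℝ) * Real.log X ^ 2
        ≤ (2 * X) * (512 * Real.exp 10 * Real.log (Real.log (3 * X)) * S) :=
          mul_le_mul hM h1 (by positivity) (by linarith)
      _ = _ := by ring
  have hcard' : (Finset.card {p ∈ dyadicPrimes X | primeGap p = h} : ℝ) ≤
      (Finset.card {p ∈ Finset.Ico ⌈X⌉₊ (⌈X⌉₊ + M) | p.Prime ∧ (p + h).Prime} : ℕ) := by
    exact_mod_cast hcard
  exact hcard'.trans (hsieve.trans (add_le_add hmain hE8))

open Filter Asymptotics in
theorem eventually_collisionProb_gapLaw_le :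
    ∀ᶠ X : ℝ in atTop, ∀ hX : 2 ≤ X, collisionProb (gapLaw X hX) ≤
      24 * (1024 * Real.exp 10 + 1) * (Real.log (Real.log (3 * X)) / Real.log X) := by
  have ho : (fun x : ℝ => Real.log x) =o[atTop] fun x => x ^ (1 / 4 : ℝ) :=
    isLittleO_log_rpow_atTop (by norm_num)
  filter_upwards [eventually_le_card_dyadicPrimes, ho.bound zero_lt_one, eventually_gt_atTop 2,
    eventually_ge_atTop (Real.exp 3)] with X hcard hlog hX2 hX3 hX
  have hlogX : 0 < Real.log X := Real.log_pos (by linarith)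
  have hX3' : Real.exp 3 ≤ 3 * X := by linarith
  have hl3 : 3 ≤ Real.log (3 * X) := (Real.le_log_iff_exp_le (by linarith)).2 hX3'
  have hll : 1 ≤ Real.log (Real.log (3 * X)) :=
    (Real.le_log_iff_exp_le (by linarith)).2 (by linarith [Real.exp_one_lt_d9])
  rw [Real.norm_of_nonneg hlogX.le, Real.norm_of_nonneg (by positivity), one_mul] at hlog
  refine collisionProb_le _ fun h => ?_
  have h1 := card_primeGap_eq_le hX2 hX3' h
  have hX0 : 0 < X := by linarith
  have hpos : 0 < X / (24 * Real.log X) := by positivity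
  set ℓ := Real.log (Real.log (3 * X))
  -- The sieve error is absorbed into the main term, which is the `+ 1` in the constant; the `24`
  -- comes from Chebyshev's bound.
  have hsq : √X ≤ X * ℓ / Real.log X ^ 2 := by
    rw [le_div_iff₀ (by positivity)]
    have h2 : Real.log X ^ 2 ≤ √X := by
      calc Real.log X ^ 2 ≤ (X ^ (1 / 4 : ℝ)) ^ 2 := pow_le_pow_left₀ hlogX.le hlog 2
        _ = √X := by
          rw [← Real.rpow_natCast, ← Real.rpow_mul hX0.le, Real.sqrt_eq_rpow]
          norm_num
    calc √X * Real.log X ^ 2 ≤ √X * √X := mul_le_mul_of_nonneg_left h2 (by positivity)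
      _ = X * 1 := by rw [Real.mul_self_sqrt hX0.le, mul_one]
      _ ≤ X * ℓ := mul_le_mul_of_nonneg_left hll hX0.le
  rw [gapLaw_toReal]
  calc _ ≤ ((1024 * Real.exp 10 + 1) * (X * ℓ / Real.log X ^ 2)) / (X / (24 * Real.log X)) := by
        refine div_le_div₀ (by positivity) ?_ hpos hcard
        linarith
    _ = _ := by field_simp

theorem exists_collisionProb_gapLaw_le :
    ∃ C : ℝ, 0 < C ∧ ∀ (X : ℝ) (hX : 2 ≤ X),
      collisionProb (gapLaw X hX) ≤ C * (Real.log (Real.log (3 * X)) / Real.log X) := by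
  obtain ⟨X₀, hX₀⟩ := Filter.eventually_atTop.1 eventually_collisionProb_gapLaw_le
  have h6 : 1 < Real.log 6 := by
    rw [Real.lt_log_iff_exp_lt (by norm_num)]
    linarith [Real.exp_one_lt_d9]
  have hl6 : 0 < Real.log (Real.log 6) := Real.log_pos h6
  have hb : 0 < Real.log (max X₀ 2) :=
    Real.log_pos (lt_of_lt_of_le one_lt_two (le_max_right _ _))
  -- The second summand covers `2 ≤ X ≤ X₀`: there `w_X ≤ 1`, while `log log (3X) / log X` is at
  -- least `log log 6 / log (max X₀ 2)`.
  refine ⟨24 * (1024 * Real.exp 10 + 1) + Real.log (max X₀ 2) / Real.log (Real.log 6),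
    by positivity, fun X hX => ?_⟩
  have hlogX : 0 < Real.log X := Real.log_pos (by linarith)
  have hll : Real.log (Real.log 6) ≤ Real.log (Real.log (3 * X)) :=
    Real.log_le_log (by linarith) (Real.log_le_log (by norm_num) (by linarith))
  have hr : 0 < Real.log (Real.log (3 * X)) / Real.log X := div_pos (hl6.trans_le hll) hlogX
  rw [add_mul]
  rcases le_total X₀ X with h | h
  · exact (hX₀ X h hX).trans (le_add_of_nonneg_right (by positivity))
  · refine (collisionProb_le_one _).trans (le_add_of_nonneg_of_le (by positivity) ?_)
    have h1 : Real.log X ≤ Real.log (max X₀ 2) :=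
      Real.log_le_log (by linarith) (h.trans (le_max_left _ _))
    rw [div_mul_div_comm, one_le_div (by positivity), mul_comm]
    exact mul_le_mul h1 hll hl6.le hb.le |>.trans' (le_of_eq (by ring))

theorem mainTheorem12 :
    -- tensorization for an arbitrary discrete law
    (∀ (m : ℕ) (α : Type*) [MeasurableSpace α] [MeasurableSingletonClass α] (ν : PMF α)
      (Ω : Type*) [MeasurableSpace Ω] (P : Measure Ω) [IsProbabilityMeasure P]
      (Z Z' : Fin m → Ω → α), IsIIDWithCopy Z Z' ν P →
        P.real {ω | (fun i => Z i ω) = (fun i => Z' i ω)} = collisionProb ν ^ m) ∧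
    -- amplification for prime gaps
    (∃ C : ℝ, 0 < C ∧ ∀ (m : ℕ) (X : ℝ) (hX : 2 ≤ X),
      (∀ (Ω : Type*) [MeasurableSpace Ω] (P : Measure Ω) [IsProbabilityMeasure P]
        (G G' : Fin m → Ω → ℕ), IsIIDWithCopy G G' (gapLaw X hX) P →
          P.real {ω | (fun i => G i ω) = (fun i => G' i ω)} =
            collisionProb (gapLaw X hX) ^ m) ∧
      collisionProb (gapLaw X hX) ^ m ≤
        C ^ m * (Real.log (Real.log (3 * X)) / Real.log X) ^ m) := by
  refine ⟨fun m α _ _ ν Ω _ P _ Z Z' h => h.measureReal_eq, ?_⟩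
  obtain ⟨C, hC, hw⟩ := exists_collisionProb_gapLaw_le
  refine ⟨C, hC, fun m X hX => ⟨fun Ω _ P _ G G' h => h.measureReal_eq, ?_⟩⟩
  rw [← mul_pow]
  exact pow_le_pow_left₀ (collisionProb_nonneg _) (hw X hX) m
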